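/- Let $p$ be a prime and let all rings be Noetherian $F$-finite rings of characteristic $p$. A Cartier $R$-algebra is an $\mathbb N$-graded ring $\mathcal C=\bigoplus_e \mathcal C_e$ with $\mathcal C_0=R$ and $r\kappa=\kappa r^{p^e}$ for all $r\in R$, $\kappa\in\mathcal C_e$; a Cartier $\mathcal C$-module is a left $\mathcal C$-module that is finite over $R$. Put $\mathcal C_+=\bigoplus_{e\ge 1}\mathcal C_e$; a map of left $\mathcal C$-modules is a nil-isomorphism if its kernel and cokernel are annihilated by a power of $\mathcal C_+$. The test module $\tau(M,\mathcal C)$ is the smallest $\mathcal C$-submodule $N\subseteq M$ such that $H^0_\eta(N_\eta)\to H^0_\eta(M_\eta)$ is a nil-isomorphism of $\mathcal C_\eta$-modules for every $\eta\in\operatorname{Ass}M$, where $\mathcal C_\eta=\mathcal C\otimes_R R_\eta$; and $(M,\mathcal C)$ is $F$-regular if $\tau(M,\mathcal C)=M$. Let $f\colon\operatorname{Spec}S\to\operatorname{Spec}R$ be a finite cover, i.e. a finite dominant morphism. Let $f^*\mathcal C=\mathcal C\otimes_R S$ be the Cartier $S$-algebra with multiplication $(\kappa\otimes s)(\kappa'\otimes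 s')=\kappa\kappa'\otimes s^{p^{e}}s'$ for $\kappa'\in\mathcal C_{e}$. For a Cartier $\mathcal C$-module $M$ let $f^!M=\operatorname{Hom}_R(S,M)$ be the Cartier $f^*\mathcal C$-module with $\big((\kappa\otimes s')\cdot\mu\big)(s)=\kappa\cdot\mu(s's^{p^e})$ for $\kappa\in\mathcal C_e$, and let $\operatorname{Tr}_M\colon f_*f^!M\to M$, $\mu\mapsto\mu(1)$. Theorem. For every finite cover $f\colon\operatorname{Spec}S\to\operatorname{Spec}R$, every Cartier $R$-algebra $\mathcal C$ and every Cartier $\mathcal C$-module $M$, the test modules $\tau(M,\mathcal C)$ and $\tau(f^!M,f^*\mathcal C)$ exist and $$\operatorname{Tr}_M\big(f_*\tau(f^!M,f^*\mathcal C)\big)=\tau(M,\mathcal C).$$ In particular, $\operatorname{Tr}_M$ is surjective if $(M,\mathcal C)$ is $F$-regular. Conversely, if $\operatorname{Tr}_M$ is surjective and $(f^!M,f^*\mathcal C)$ is $F$-regular, then $(M,\mathcal C)$ is $F$-regular. -/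

import Mathlib

open scoped TensorProduct

universe u v w x

noncomputable section

theorem tensorAddHom_ext {R : Type*} [CommRing R] {M N P : Type*} [AddCommGroup M] [Module R M]
    [AddCommGroup N] [Module R N] [AddCommGroup P] {f g : M ⊗[R] N →+ P}
    (h : ∀ m n, f (m ⊗ₜ n) = g (m ⊗ₜ n)) : f = g := by
  ext y
  induction y with
  | zero => simp
  | add y z hy hz => rw [map_add, map_add, hy, hz]
  | tmul m n => exact h m n

/-- A Cartier algebra over a ring `R` (of characteristic `p`): an `ℕ`-graded ring
`C = ⨁ₑ Cₑ`, given by its homogeneous pieces `gr e = Cₑ` and the multiplication maps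
`C_d × C_e → C_{d+e}`, with an identification `R ≃ C₀`, and such that
`r · κ = κ · r ^ (p ^ e)` for all `r : R` and `κ : Cₑ`.
The scalar multiplication `r • κ` on `gr e` is the *right* `R`-module structure `κ · r`
(`R` is commutative); the left one is multiplication by `ofR r` on the left.
The unit of the ring is `ofR 1`; it is two-sided by `mul_ofR` and `ofR_mul`. -/
structure CartierAlgebra (p : ℕ) (R : Type u) [CommRing R] where
  /-- the homogeneous piece of degree `e` -/
  gr : ℕ → Type v
  [addCommGroup : ∀ e, AddCommGroup (gr e)]
  /-- the right `R`-module structure of the homogeneous pieces -/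
  [module : ∀ e, Module R (gr e)]
  /-- multiplication of homogeneous elements -/
  mul : ∀ {d e n : ℕ}, d + e = n → gr d →+ gr e →+ gr n
  mul_assoc : ∀ {a b c ab bc n : ℕ} (hab : a + b = ab) (hbc : b + c = bc)
    (h₁ : ab + c = n) (h₂ : a + bc = n) (α : gr a) (β : gr b) (γ : gr c),
    mul h₁ (mul hab α β) γ = mul h₂ α (mul hbc β γ)
  /-- the identification of `R` with the piece of degree `0` -/
  ofR : R ≃ₗ[R] gr 0
  mul_ofR : ∀ {e : ℕ} (κ : gr e) (r : R), mul (Nat.add_zero e) κ (ofR r) = r • κ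
  ofR_mul : ∀ {e : ℕ} (r : R) (κ : gr e), mul (Nat.zero_add e) (ofR r) κ = r ^ p ^ e • κ

attribute [instance] CartierAlgebra.addCommGroup CartierAlgebra.module

namespace CartierAlgebra

variable {p : ℕ} {R : Type u} [CommRing R] (C : CartierAlgebra.{u, v} p R)

theorem mul_smul {d e n : ℕ} (h : d + e = n) (κ : C.gr d) (r : R) (lam : C.gr e) :
    C.mul h κ (r • lam) = r • C.mul h κ lam := by
  rw [← C.mul_ofR lam r, ← C.mul_ofR (C.mul h κ lam) r]
  exact (C.mul_assoc h (Nat.add_zero e) (Nat.add_zero n) h κ lam (C.ofR r)).symm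

theorem smul_mul {d e n : ℕ} (h : d + e = n) (r : R) (κ : C.gr d) (lam : C.gr e) :
    C.mul h (r • κ) lam = r ^ p ^ e • C.mul h κ lam := by
  rw [← C.mul_ofR κ r, C.mul_assoc (Nat.add_zero d) (Nat.zero_add e) h h, C.ofR_mul, C.mul_smul]

end CartierAlgebra

section Frobenius

variable (p : ℕ) [Fact p.Prime] (R : Type u) [CommRing R] [CharP R p]
  (S : Type w) [CommRing S] [Algebra R S]

/-- The `e`-th iterate `s ↦ s ^ (p ^ e)` of Frobenius on an algebra `S` over a ring `R` of
characteristic `p`. -/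
def frobPow (e : ℕ) : S →+* S where
  toFun s := s ^ p ^ e
  map_one' := one_pow _
  map_mul' a b := mul_pow a b _
  map_zero' := zero_pow (pow_ne_zero _ (Fact.out : p.Prime).ne_zero)
  map_add' a b := by
    obtain ⟨r, hr⟩ := exists_add_pow_prime_pow_eq (Fact.out : p.Prime) a b e
    have h0 : (p : S) = 0 := by
      rw [← map_natCast (algebraMap R S) p, CharP.cast_eq_zero, map_zero]
    rw [hr, h0]
    ring

@[simp]
theorem frobPow_apply (e : ℕ) (s : S) : frobPow p R S e s = s ^ p ^ e := rfl

end Frobenius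

namespace CartierAlgebra

variable {p : ℕ} [Fact p.Prime] {R : Type u} [CommRing R] [CharP R p]
  (C : CartierAlgebra.{u, v} p R) (S : Type w) [CommRing S] [Algebra R S]

/-- `κ' ↦ κ · κ'` as a linear map for the right `R`-module structures. -/
def mulLin {d e n : ℕ} (h : d + e = n) (κ : C.gr d) : C.gr e →ₗ[R] C.gr n where
  toFun lam := C.mul h κ lam
  map_add' := map_add _
  map_smul' r lam := C.mul_smul h κ r lam

/-- Multiplication on `S ⊗ C`: `(s ⊗ κ) · (s' ⊗ κ') = s ^ (p ^ e) s' ⊗ κ κ'`, `e = deg κ'`. -/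
def pullbackMul {d e n : ℕ} (h : d + e = n) :
    (S ⊗[R] C.gr d) →+ (S ⊗[R] C.gr e) →+ (S ⊗[R] C.gr n) :=
  TensorProduct.liftAddHom
    (AddMonoidHom.mk'
      (fun s => AddMonoidHom.mk'
        (fun κ => (TensorProduct.map (LinearMap.mulLeft R (frobPow p R S e s))
          (C.mulLin h κ)).toAddMonoidHom)
        (fun κ κ' => by
          refine tensorAddHom_ext fun t lam => ?_
          simp [mulLin, TensorProduct.tmul_add]))
      (fun s s' => by
        ext κ : 1
        refine tensorAddHom_ext fun t lam => ?_
        simp only [map_add]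
        simp [add_mul, TensorProduct.add_tmul]))
    (fun r s κ => by
      refine tensorAddHom_ext fun t lam => ?_
      change ((r • s) ^ p ^ e * t) ⊗ₜ[R] C.mul h κ lam = (s ^ p ^ e * t) ⊗ₜ[R] C.mul h (r • κ) lam
      rw [C.smul_mul, smul_pow, smul_mul_assoc, TensorProduct.smul_tmul])

@[simp]
theorem pullbackMul_tmul {d e n : ℕ} (h : d + e = n) (s t : S) (κ : C.gr d) (lam : C.gr e) :
    C.pullbackMul S h (s ⊗ₜ κ) (t ⊗ₜ lam) = (s ^ p ^ e * t) ⊗ₜ C.mul h κ lam := rfl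

/-- The pullback `f^* C` of a Cartier `R`-algebra along `R → S`: the graded right `S`-module
`C ⊗_R S` (written `S ⊗_R C`, for the right `R`-module structure of `C`), with the multiplication
`(κ ⊗ s) · (κ' ⊗ s') = κ κ' ⊗ s ^ (p ^ e) s'`, `e = deg κ'`. -/
def pullback : CartierAlgebra.{w, max v w} p S where
  gr e := S ⊗[R] C.gr e
  mul h := C.pullbackMul S h
  mul_assoc {a b c ab bc n} hab hbc h₁ h₂ α β γ := by
    induction α with
    | zero => simp
    | add x y hx hy => simp [hx, hy]
    | tmul s κ =>
      induction β with
      | zero => simp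
      | add x y hx hy => simp [hx, hy]
      | tmul t lam =>
        induction γ with
        | zero => simp
        | add x y hx hy => simp only [map_add, hx, hy]
        | tmul r ν =>
          simp only [pullbackMul_tmul, C.mul_assoc hab hbc h₁ h₂]
          congr 1
          rw [mul_pow, ← pow_mul, ← pow_add, hbc, _root_.mul_assoc]
  ofR := (TensorProduct.AlgebraTensorModule.rid R S S).symm.trans
    (TensorProduct.AlgebraTensorModule.congr (LinearEquiv.refl S S) C.ofR)
  mul_ofR {e} κ r := by
    induction κ with
    | zero => simp
    | add x y hx hy => simp only [map_add, AddMonoidHom.add_apply, smul_add, hx, hy]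
    | tmul s κ =>
      simp [C.mul_ofR, TensorProduct.smul_tmul', mul_comm]
  ofR_mul {e} r κ := by
    induction κ with
    | zero => simp
    | add x y hx hy => simp only [map_add, smul_add, hx, hy]
    | tmul s κ =>
      simp [C.ofR_mul, TensorProduct.smul_tmul']

@[simp]
theorem pullback_mul_tmul {d e n : ℕ} (h : d + e = n) (s t : S) (κ : C.gr d) (lam : C.gr e) :
    (C.pullback S).mul h (s ⊗ₜ[R] κ : S ⊗[R] C.gr d) (t ⊗ₜ[R] lam : S ⊗[R] C.gr e) =
      ((s ^ p ^ e * t) ⊗ₜ[R] C.mul h κ lam : S ⊗[R] C.gr n) := rfl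

theorem pullback_ofR (s : S) :
    (C.pullback S).ofR s = (s ⊗ₜ[R] C.ofR 1 : S ⊗[R] C.gr 0) := rfl

end CartierAlgebra

/-- A left module structure over the Cartier algebra `C` on an `R`-module `M`, extending its
`R`-module structure. A Cartier module is a finite `R`-module with such a structure. -/
structure CartierAction {p : ℕ} {R : Type u} [CommRing R] (C : CartierAlgebra.{u, v} p R)
    (M : Type x) [AddCommGroup M] [Module R M] where
  /-- the action of homogeneous elements -/
  act : ∀ {e : ℕ}, C.gr e →+ M →+ M
  act_ofR : ∀ (r : R) (m : M), act (C.ofR r) m = r • m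
  act_mul : ∀ {d e n : ℕ} (h : d + e = n) (κ : C.gr d) (lam : C.gr e) (m : M),
    act (C.mul h κ lam) m = act κ (act lam m)

namespace CartierAction

variable {p : ℕ} {R : Type u} [CommRing R] {C : CartierAlgebra.{u, v} p R}
  {M : Type x} [AddCommGroup M] [Module R M] (A : CartierAction C M)

theorem act_smul_left {e : ℕ} (r : R) (κ : C.gr e) (m : M) :
    A.act (r • κ) m = A.act κ (r • m) := by
  rw [← C.mul_ofR, A.act_mul, A.act_ofR]

theorem act_pow_smul {e : ℕ} (r : R) (κ : C.gr e) (m : M) :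
    A.act κ (r ^ p ^ e • m) = r • A.act κ m := by
  rw [← A.act_smul_left, ← C.ofR_mul, A.act_mul, A.act_ofR]

/-- `N` is a Cartier submodule, i.e. stable under `C`. -/
def IsCartierSubmodule (N : Submodule R M) : Prop :=
  ∀ (e : ℕ) (κ : C.gr e), ∀ m ∈ N, A.act κ m ∈ N

/-- `C₊ N`, where `C₊ = ⨁_{e ≥ 1} Cₑ`. -/
def plus (N : Submodule R M) : Submodule R M :=
  Submodule.span R {y | ∃ e : ℕ, 1 ≤ e ∧ ∃ κ : C.gr e, ∃ m ∈ N, A.act κ m = y}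

/-- The inclusion `N ⊆ N'` of submodules is a nil-isomorphism: the kernel is zero, and
the cokernel `N' / N` is annihilated by some power of `C₊`. -/
def IsNilIsoInclusion (N N' : Submodule R M) : Prop :=
  N ≤ N' ∧ ∃ n : ℕ, A.plus^[n] N' ≤ N

end CartierAction

/-- `H⁰_I(N)`: the elements of the submodule `N` that are annihilated by a power of `I`. -/
def localCohomologyZero {R : Type u} [CommRing R] {M : Type x} [AddCommGroup M] [Module R M]
    (I : Ideal R) (N : Submodule R M) : Submodule R M where
  carrier := {m | m ∈ N ∧ ∃ k : ℕ, ∀ a ∈ I ^ k, a • m = 0}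
  zero_mem' := ⟨N.zero_mem, 0, fun a _ => smul_zero a⟩
  add_mem' := by
    rintro m m' ⟨hm, k, hk⟩ ⟨hm', k', hk'⟩
    refine ⟨N.add_mem hm hm', k + k', fun a ha => ?_⟩
    rw [smul_add, hk a (Ideal.pow_le_pow_right (Nat.le_add_right k k') ha),
      hk' a (Ideal.pow_le_pow_right (Nat.le_add_left k' k) ha), add_zero]
  smul_mem' := by
    rintro r m ⟨hm, k, hk⟩
    exact ⟨N.smul_mem r hm, k, fun a ha => by rw [smul_comm, hk a ha, smul_zero]⟩

namespace CartierAction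

section Localization

variable {p : ℕ} [Fact p.Prime] {R : Type u} [CommRing R] [CharP R p]
  {C : CartierAlgebra.{u, v} p R} {M : Type x} [AddCommGroup M] [Module R M]
  (A : CartierAction C M) (W : Submonoid R)

/-- The action of `κ : Cₑ` on a localization: `m / t ↦ κ (t ^ (p ^ e - 1) m) / t`. -/
def locFun {e : ℕ} (κ : C.gr e) (y : LocalizedModule W M) : LocalizedModule W M :=
  y.liftOn (fun mt => LocalizedModule.mk (A.act κ ((mt.2 : R) ^ (p ^ e - 1) • mt.1)) mt.2)
    (by
      have hq : p ^ e ≠ 0 := pow_ne_zero _ (Fact.out : p.Prime).ne_zero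
      rintro ⟨m, t⟩ ⟨m', t'⟩ ⟨c, hc⟩
      refine LocalizedModule.mk_eq.mpr ⟨c, ?_⟩
      simp only [Submonoid.smul_def, ← A.act_pow_smul] at hc ⊢
      congr 1
      obtain ⟨q, hq'⟩ := Nat.exists_eq_succ_of_ne_zero hq
      rw [hq', Nat.succ_sub_one, Nat.succ_eq_add_one]
      have := congrArg (fun z => ((c : R) ^ q * (t : R) ^ q * (t' : R) ^ q) • z) hc
      simp only [smul_smul] at this ⊢
      convert this using 2 <;> ring_nf)

theorem locFun_mk {e : ℕ} (κ : C.gr e) (m : M) (t : W) :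
    A.locFun W κ (LocalizedModule.mk m t) =
      LocalizedModule.mk (A.act κ ((t : R) ^ (p ^ e - 1) • m)) t := rfl

theorem locFun_mk_pow {e : ℕ} (κ : C.gr e) (m : M) (t : W) :
    A.locFun W κ (LocalizedModule.mk m (t ^ p ^ e)) = LocalizedModule.mk (A.act κ m) t := by
  have hq : p ^ e ≠ 0 := pow_ne_zero _ (Fact.out : p.Prime).ne_zero
  obtain ⟨q, hq'⟩ := Nat.exists_eq_succ_of_ne_zero hq
  rw [locFun_mk]
  refine LocalizedModule.mk_eq.mpr ⟨1, ?_⟩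
  simp only [Submonoid.smul_def, ← A.act_pow_smul, smul_smul]
  congr 2
  rw [hq', Nat.succ_sub_one, Nat.succ_eq_add_one]
  push_cast
  ring_nf

theorem exists_mk_pow (e : ℕ) (y : LocalizedModule W M) :
    ∃ (m : M) (t : W), y = LocalizedModule.mk m (t ^ p ^ e) := by
  have hq : p ^ e ≠ 0 := pow_ne_zero _ (Fact.out : p.Prime).ne_zero
  obtain ⟨q, hq'⟩ := Nat.exists_eq_succ_of_ne_zero hq
  induction y using LocalizedModule.induction_on with
  | h m t =>
    refine ⟨t ^ q • m, t, ?_⟩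
    rw [hq', pow_succ, LocalizedModule.mk_cancel_common_left]

theorem exists_mk_pow₂ (e : ℕ) (y z : LocalizedModule W M) :
    ∃ (m n : M) (t : W), y = LocalizedModule.mk m (t ^ p ^ e) ∧
      z = LocalizedModule.mk n (t ^ p ^ e) := by
  obtain ⟨m, s, rfl⟩ := exists_mk_pow (p := p) W e y
  obtain ⟨n, t, rfl⟩ := exists_mk_pow (p := p) W e z
  refine ⟨t ^ p ^ e • m, s ^ p ^ e • n, s * t, ?_, ?_⟩
  · rw [mul_pow, LocalizedModule.mk_cancel_common_right]
  · rw [mul_pow, LocalizedModule.mk_cancel_common_left]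

theorem mk_add_mk_same (m n : M) (t : W) :
    LocalizedModule.mk m t + LocalizedModule.mk n t = LocalizedModule.mk (m + n) t := by
  rw [LocalizedModule.mk_add_mk, ← smul_add, LocalizedModule.mk_cancel_common_left]

theorem locFun_add {e : ℕ} (κ : C.gr e) (y z : LocalizedModule W M) :
    A.locFun W κ (y + z) = A.locFun W κ y + A.locFun W κ z := by
  obtain ⟨m, n, t, rfl, rfl⟩ := exists_mk_pow₂ (p := p) W e y z
  rw [mk_add_mk_same, locFun_mk_pow, locFun_mk_pow, locFun_mk_pow, mk_add_mk_same, map_add]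

theorem locFun_pow_smul {e : ℕ} (κ : C.gr e) (a : Localization W) (y : LocalizedModule W M) :
    A.locFun W κ (a ^ p ^ e • y) = a • A.locFun W κ y := by
  obtain ⟨m, t, rfl⟩ := exists_mk_pow (p := p) W e y
  induction a using Localization.induction_on with
  | H rs =>
    obtain ⟨r, s⟩ := rs
    rw [Localization.mk_pow, LocalizedModule.mk_smul_mk, ← mul_pow, locFun_mk_pow, locFun_mk_pow,
      LocalizedModule.mk_smul_mk, A.act_pow_smul]

theorem locFun_add_left {e : ℕ} (κ κ' : C.gr e) (y : LocalizedModule W M) :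
    A.locFun W (κ + κ') y = A.locFun W κ y + A.locFun W κ' y := by
  obtain ⟨m, t, rfl⟩ := exists_mk_pow (p := p) W e y
  rw [locFun_mk_pow, locFun_mk_pow, locFun_mk_pow, mk_add_mk_same, map_add,
    AddMonoidHom.add_apply]

theorem locFun_smul_left {e : ℕ} (r : R) (κ : C.gr e) (y : LocalizedModule W M) :
    A.locFun W (r • κ) y = A.locFun W κ (r • y) := by
  obtain ⟨m, t, rfl⟩ := exists_mk_pow (p := p) W e y
  rw [LocalizedModule.smul'_mk, locFun_mk_pow, locFun_mk_pow, A.act_smul_left]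

theorem locFun_mul {d e n : ℕ} (h : d + e = n) (κ : C.gr d) (lam : C.gr e)
    (y : LocalizedModule W M) :
    A.locFun W (C.mul h κ lam) y = A.locFun W κ (A.locFun W lam y) := by
  obtain ⟨m, t, rfl⟩ := exists_mk_pow (p := p) W n y
  have hn : t ^ p ^ n = (t ^ p ^ d) ^ p ^ e := by rw [← h, pow_add, pow_mul]
  rw [locFun_mk_pow, hn, locFun_mk_pow, locFun_mk_pow, A.act_mul]

theorem locFun_one (y : LocalizedModule W M) : A.locFun W (C.ofR 1) y = y := by
  induction y using LocalizedModule.induction_on with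
  | h m t => simp [locFun_mk, A.act_ofR]

/-- The action `(κ ⊗ a) · y = κ (a y)` of `C ⊗_R W⁻¹R` on `W⁻¹M`. -/
def locAct {e : ℕ} :
    (Localization W ⊗[R] C.gr e) →+ LocalizedModule W M →+ LocalizedModule W M :=
  TensorProduct.liftAddHom
    (AddMonoidHom.mk'
      (fun a => AddMonoidHom.mk'
        (fun κ => AddMonoidHom.mk' (fun y => A.locFun W κ (a • y))
          (fun y z => by rw [smul_add, locFun_add]))
        (fun κ κ' => by ext y; exact A.locFun_add_left W κ κ' _))
      (fun a b => by
        ext κ y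
        change A.locFun W κ ((a + b) • y) = A.locFun W κ (a • y) + A.locFun W κ (b • y)
        rw [add_smul, locFun_add]))
    (fun r a κ => by
      ext y
      change A.locFun W κ ((r • a) • y) = A.locFun W (r • κ) (a • y)
      rw [locFun_smul_left, smul_assoc])

@[simp]
theorem locAct_tmul {e : ℕ} (a : Localization W) (κ : C.gr e) (y : LocalizedModule W M) :
    A.locAct W (a ⊗ₜ κ) y = A.locFun W κ (a • y) := rfl

theorem locAct_mul {d e n : ℕ} (h : d + e = n) (κ : Localization W ⊗[R] C.gr d)
    (lam : Localization W ⊗[R] C.gr e) (y : LocalizedModule W M) :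
    A.locAct W (C.pullbackMul (Localization W) h κ lam) y =
      A.locAct W κ (A.locAct W lam y) := by
  induction κ with
  | zero => simp
  | add κ κ' h₁ h₂ => simp only [map_add, AddMonoidHom.add_apply, h₁, h₂]
  | tmul a κ =>
    induction lam with
    | zero => simp only [map_zero, AddMonoidHom.zero_apply]
    | add lam lam' h₁ h₂ => simp only [map_add, AddMonoidHom.add_apply, h₁, h₂]
    | tmul b lam =>
      rw [CartierAlgebra.pullbackMul_tmul, locAct_tmul, locAct_tmul, locAct_tmul, locFun_mul,
        SemigroupAction.mul_smul, locFun_pow_smul]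

/-- The localization `W⁻¹M` is a module over `W⁻¹C = C ⊗_R W⁻¹R`, by
`(κ ⊗ a) · y = κ (a y)` and `κ (m / t) = κ (t ^ (p ^ e - 1) m) / t` for `κ : Cₑ`. -/
def localization : CartierAction (C.pullback (Localization W)) (LocalizedModule W M) where
  act := A.locAct W
  act_ofR a y := A.locFun_one W (a • y)
  act_mul h κ lam y := A.locAct_mul W h κ lam y

end Localization

section TestModule

variable {p : ℕ} [Fact p.Prime] {R : Type u} [CommRing R] [CharP R p]
  {C : CartierAlgebra.{u, v} p R} {M : Type x} [AddCommGroup M] [Module R M]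
  (A : CartierAction C M)

/-- The Cartier submodules `N` of `M` such that, for every associated prime `η` of `M`,
`H⁰_η(N_η) → H⁰_η(M_η)` is a nil-isomorphism of `C_η`-modules. -/
def testFamily : Set (Submodule R M) :=
  {N | A.IsCartierSubmodule N ∧ ∀ (η : Ideal R) [η.IsPrime], η ∈ associatedPrimes R M →
    (A.localization η.primeCompl).IsNilIsoInclusion
      (localCohomologyZero (η.map (algebraMap R (Localization.AtPrime η)))
        (N.localized η.primeCompl))
      (localCohomologyZero (η.map (algebraMap R (Localization.AtPrime η))) ⊤)}

/-- `T` is the test module of `(M, C)`: the smallest element of `testFamily`. -/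
def IsTestModule (T : Submodule R M) : Prop :=
  IsLeast A.testFamily T

/-- The test module `τ(M, C)`: the intersection of all elements of `testFamily`, which is
the smallest element whenever there is one. -/
def testModule : Submodule R M :=
  sInf A.testFamily

/-- `(M, C)` is `F`-regular: `τ(M, C)` is the whole of `M`. -/
def IsFRegular : Prop :=
  A.testModule = ⊤

end TestModule

end CartierAction

/-- `f^! M = Hom_R(S, M)`, as an `S`-module by `(s • μ)(t) = μ(s t)`. -/
def UpperShriek (R : Type u) (S : Type w) (M : Type x) [CommRing R] [CommRing S] [Algebra R S]
    [AddCommGroup M] [Module R M] : Type (max w x) :=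
  S →ₗ[R] M

namespace UpperShriek

variable {R : Type u} {S : Type w} {M : Type x} [CommRing R] [CommRing S] [Algebra R S]
  [AddCommGroup M] [Module R M]

instance : AddCommGroup (UpperShriek R S M) := inferInstanceAs (AddCommGroup (S →ₗ[R] M))

instance : Module R (UpperShriek R S M) := inferInstanceAs (Module R (S →ₗ[R] M))

instance : FunLike (UpperShriek R S M) S M := inferInstanceAs (FunLike (S →ₗ[R] M) S M)

instance : LinearMapClass (UpperShriek R S M) R S M :=
  inferInstanceAs (LinearMapClass (S →ₗ[R] M) R S M)

@[ext]
theorem ext {μ ν : UpperShriek R S M} (h : ∀ s, μ s = ν s) : μ = ν := DFunLike.ext _ _ h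

@[simp]
theorem add_apply (μ ν : UpperShriek R S M) (s : S) : (μ + ν) s = μ s + ν s := rfl

@[simp]
theorem zero_apply (s : S) : (0 : UpperShriek R S M) s = 0 := rfl

@[simp]
theorem base_smul_apply (r : R) (μ : UpperShriek R S M) (s : S) : (r • μ) s = r • μ s := rfl

instance : SMul S (UpperShriek R S M) where
  smul s μ := LinearMap.comp (μ : S →ₗ[R] M) (LinearMap.mulLeft R s)

@[simp]
theorem smul_apply (s : S) (μ : UpperShriek R S M) (t : S) : (s • μ) t = μ (s * t) := rfl

instance : Module S (UpperShriek R S M) where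
  one_smul μ := by ext; simp
  mul_smul s t μ := by ext r; simp only [smul_apply]; congr 1; ring
  smul_zero s := by ext; simp
  smul_add s μ ν := by ext; simp
  add_smul s t μ := by ext; simp [add_mul]
  zero_smul μ := by ext; simp

instance : IsScalarTower R S (UpperShriek R S M) where
  smul_assoc r s μ := by ext t; simp

variable (R S M) in
/-- The trace `Tr_M : f_* f^! M → M`, evaluation at `1`. -/
def trace : UpperShriek R S M →ₗ[R] M where
  toFun μ := μ 1
  map_add' _ _ := rfl
  map_smul' _ _ := rfl

end UpperShriek

namespace CartierAction

variable {p : ℕ} [Fact p.Prime] {R : Type u} [CommRing R] [CharP R p]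
  {C : CartierAlgebra.{u, v} p R} {M : Type x} [AddCommGroup M] [Module R M]
  (A : CartierAction C M) (S : Type w) [CommRing S] [Algebra R S]

/-- `κ ⊗ a` acting on `μ : f^! M`: the map `s ↦ κ · μ (a s ^ (p ^ e))`. -/
def shriekFun {e : ℕ} (a : S) (κ : C.gr e) (μ : UpperShriek R S M) : UpperShriek R S M :=
  { toFun := fun s => A.act κ (μ (a * s ^ p ^ e))
    map_add' := fun s t => by
      rw [← frobPow_apply p R S, ← frobPow_apply p R S, ← frobPow_apply p R S, map_add, mul_add,
        map_add, map_add]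
    map_smul' := fun r s => by
      rw [smul_pow, mul_smul_comm, map_smul, A.act_pow_smul, RingHom.id_apply] :
    S →ₗ[R] M }

@[simp]
theorem shriekFun_apply {e : ℕ} (a : S) (κ : C.gr e) (μ : UpperShriek R S M) (s : S) :
    A.shriekFun S a κ μ s = A.act κ (μ (a * s ^ p ^ e)) := rfl

/-- The action `((κ ⊗ a) · μ)(s) = κ · μ (a s ^ (p ^ e))` of `C ⊗_R S` on `f^! M`. -/
def shriekAct {e : ℕ} : (S ⊗[R] C.gr e) →+ UpperShriek R S M →+ UpperShriek R S M :=
  TensorProduct.liftAddHom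
    (AddMonoidHom.mk'
      (fun a => AddMonoidHom.mk'
        (fun κ => AddMonoidHom.mk' (fun μ => A.shriekFun S a κ μ)
          (fun μ ν => by ext s; simp))
        (fun κ κ' => by ext μ s; simp))
      (fun a b => by ext κ μ s; simp [add_mul]))
    (fun r a κ => by
      ext μ s
      simp [A.act_smul_left])

@[simp]
theorem shriekAct_tmul {e : ℕ} (a : S) (κ : C.gr e) (μ : UpperShriek R S M) :
    A.shriekAct S (a ⊗ₜ κ) μ = A.shriekFun S a κ μ := rfl

theorem shriekAct_mul {d e n : ℕ} (h : d + e = n) (κ : S ⊗[R] C.gr d) (lam : S ⊗[R] C.gr e)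
    (μ : UpperShriek R S M) :
    A.shriekAct S (C.pullbackMul S h κ lam) μ = A.shriekAct S κ (A.shriekAct S lam μ) := by
  induction κ with
  | zero => simp
  | add κ κ' h₁ h₂ => simp only [map_add, AddMonoidHom.add_apply, h₁, h₂]
  | tmul a κ =>
    induction lam with
    | zero => simp only [map_zero, AddMonoidHom.zero_apply]
    | add lam lam' h₁ h₂ => simp only [map_add, AddMonoidHom.add_apply, h₁, h₂]
    | tmul b lam =>
      ext s
      have hs : s ^ p ^ n = (s ^ p ^ d) ^ p ^ e := by rw [← h, pow_add, pow_mul]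
      simp only [CartierAlgebra.pullbackMul_tmul, shriekAct_tmul, shriekFun_apply, A.act_mul, hs]
      congr 3
      ring

/-- The `f^* C`-module structure of `f^! M`:
`((κ ⊗ a) · μ)(s) = κ · μ (a s ^ (p ^ e))` for `κ : Cₑ`. -/
def upperShriek : CartierAction (C.pullback S) (UpperShriek R S M) where
  act := A.shriekAct S
  act_ofR a μ := by
    change A.shriekFun S a (C.ofR 1) μ = a • μ
    ext s
    simp [A.act_ofR]
  act_mul h κ lam μ := A.shriekAct_mul S h κ lam μ

end CartierAction

end

open scoped Pointwise nonZeroDivisors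

/-!
A submodule `N` belongs to the test family of `M` iff it is a Cartier submodule and, for every
`η ∈ Ass M`, some power of `C₊` maps the `η`-torsion `M[η]` into `N_η`. The map `N' ↦ Tr (f_* N')`
is left adjoint to `N ↦ f^! N`, and both preserve these conditions because the associated primes of
`f^! M` are exactly the primes over those of `M`. So they match the smallest elements of the two
test families.

For the existence of `τ(M, C)`, it suffices to find for each `η` a smallest Cartier submodule
satisfying the condition at `η`: the sum of these is `τ(M, C)`. By the same adjunction for
`R → R/η` one may replace `R` by a domain `D` and `η` by `0`. By rank reasons some `Q = C₊ ^ n M`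
satisfies `c Q ⊆ C₊ Q` with `c ≠ 0`. For a suitable `c`, every Cartier submodule `N` that contains
some `d Q`, `d ≠ 0`, contains `c ^ k Q` for some `k`, and then even `c ^ 3 Q`, so that the Cartier
submodule generated by `c ^ 3 Q` is the smallest one.

To find `c`, let `P_b ⊆ Hom_D(F^b_* D, M)` be generated by the maps `s ↦ κ (s ^ p ^ (e - b) v)` with
`κ ∈ C_e`, `e ≥ b` and `v ∈ Q`. Then `P_{b+1} ⊆ Hom_D(F_* D, P_b)`, and taking `Hom_D(F_* D, -)`
does not increase the rank, so this inclusion is generically an equality for some `b`. Hence, for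
`N` saturated with respect to `c`, the ideal `J = (N : Q)` is stable under the coordinates `π` of
`D` with respect to a generic basis over `D ^ p`. This gives `a ^ p J ⊆ J ^ p ⊆ J ^ 2` for a divisor
`a` of `c` independent of `N`, and therefore `J` contains a power of `a`.
-/

/-! ### Saturation -/

section Saturation

variable {R : Type*} [CommRing R] {M : Type*} [AddCommGroup M] [Module R M]
  {W : Submonoid R} {N N' : Submodule R M}

variable (W N) in
/-- The `W`-saturation of `N`: the preimage of `W⁻¹N` under `M → W⁻¹M`. -/
def saturation : Submodule R M where
  carrier := {m | ∃ c ∈ W, c • m ∈ N}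
  zero_mem' := ⟨1, W.one_mem, by simp⟩
  add_mem' := by
    rintro m n ⟨c, hc, hm⟩ ⟨d, hd, hn⟩
    refine ⟨c * d, W.mul_mem hc hd, ?_⟩
    rw [smul_add, mul_comm c d, mul_smul, mul_comm d c, mul_smul]
    exact N.add_mem (N.smul_mem d hm) (N.smul_mem c hn)
  smul_mem' := by
    rintro r m ⟨c, hc, hm⟩
    exact ⟨c, hc, by rw [smul_comm]; exact N.smul_mem r hm⟩

theorem le_saturation : N ≤ saturation W N := fun m hm => ⟨1, W.one_mem, by rwa [one_smul]⟩

theorem saturation_mono (h : N ≤ N') : saturation W N ≤ saturation W N' :=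
  fun _ ⟨c, hc, hm⟩ => ⟨c, hc, h hm⟩

theorem saturation_le_saturation_iff : saturation W N ≤ saturation W N' ↔ N ≤ saturation W N' := by
  refine ⟨le_saturation.trans, fun h m ⟨c, hc, hm⟩ => ?_⟩
  obtain ⟨d, hd, hm'⟩ := h hm
  exact ⟨d * c, W.mul_mem hd hc, by rwa [mul_smul]⟩

theorem le_saturation_of_smul_le {c : R} (hc : c ∈ W) (h : c • N ≤ N') : N ≤ saturation W N' :=
  fun m hm => ⟨c, hc, h (Submodule.smul_mem_pointwise_smul m c N hm)⟩

theorem exists_smul_le_of_le_saturation (hN : N.FG) (h : N ≤ saturation W N') :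
    ∃ c ∈ W, c • N ≤ N' := by
  classical
  obtain ⟨s, rfl⟩ := hN
  choose! f hfW hf using fun x (hx : x ∈ s) => h (Submodule.subset_span hx)
  refine ⟨∏ x ∈ s, f x, W.prod_mem hfW, ?_⟩
  rw [Submodule.smul_span, Submodule.span_le]
  rintro _ ⟨x, hx, rfl⟩
  change (∏ x ∈ s, f x) • x ∈ N'
  rw [← Finset.prod_erase_mul s f hx, mul_smul]
  exact N'.smul_mem _ (hf x hx)

theorem mk_mem_localized_iff {m : M} {s : W} :
    LocalizedModule.mk m s ∈ N.localized W ↔ m ∈ saturation W N := by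
  simp only [Submodule.localized, Submodule.mem_localized', ← IsLocalizedModule.mk_eq_mk']
  constructor
  · rintro ⟨n, hn, t, h⟩
    obtain ⟨c, hc⟩ := LocalizedModule.mk_eq.mp h
    refine ⟨c * t, mul_mem c.2 t.2, ?_⟩
    rw [mul_smul]
    exact hc ▸ N.smul_mem _ (N.smul_mem _ hn)
  · rintro ⟨c, hc, h⟩
    exact ⟨c • m, h, ⟨c, hc⟩ * s, LocalizedModule.mk_cancel_common_left ⟨c, hc⟩ s m⟩

theorem localized_le_localized_iff : N.localized W ≤ N'.localized W ↔ N ≤ saturation W N' := by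
  refine ⟨fun h m hm => (mk_mem_localized_iff (s := 1)).mp (h <| mk_mem_localized_iff.mpr <|
    le_saturation hm), fun h y => ?_⟩
  induction y using LocalizedModule.induction_on with
  | h m s =>
    rw [mk_mem_localized_iff, mk_mem_localized_iff]
    exact fun hm => saturation_le_saturation_iff.mpr h hm

end Saturation

section Domain

variable {D : Type*} [CommRing D] [IsDomain D]

theorem le_saturation_of_finrank_le {M : Type*} [AddCommGroup M] [Module D M]
    {N N' : Submodule D M} [Module.Finite D N'] (h : N ≤ N')
    (hrank : Module.finrank D N' ≤ Module.finrank D N) : N' ≤ saturation D⁰ N := by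
  have hzero : Module.finrank D (N' ⧸ N.submoduleOf N') = 0 := by
    rw [Submodule.finrank_quotient, (Submodule.submoduleOfEquivOfLe h).finrank_eq,
      Nat.sub_eq_zero_of_le hrank]
  intro m hm
  obtain ⟨c, hc⟩ := Module.finrank_eq_zero_iff_isTorsion.mp hzero
    (x := Submodule.Quotient.mk ⟨m, hm⟩)
  rw [Submonoid.smul_def, ← Submodule.Quotient.mk_smul, Submodule.Quotient.mk_eq_zero] at hc
  exact ⟨c, c.2, hc⟩

theorem exists_smul_eq_sum_dual_smul (D L : Type*) [CommRing D] [IsDomain D] [AddCommGroup L]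
    [Module D L] [Module.Finite D L] :
    ∃ (n : ℕ) (β : Fin n → L) (π : Fin n → Module.Dual D L) (c : D), LinearIndependent D β ∧
      c ≠ 0 ∧ ∀ x, c • x = ∑ j, π j x • β j := by
  obtain ⟨β, hβ⟩ := exists_linearIndependent_of_le_finrank (R := D) (M := L) le_rfl
  have hspan : Module.finrank D (Submodule.span D (Set.range β)) = Module.finrank D L := by
    rw [finrank_span_eq_card hβ, Fintype.card_fin]
  obtain ⟨c, hc, hle⟩ := exists_smul_le_of_le_saturation Module.Finite.fg_top <|
    le_saturation_of_finrank_le (le_top : Submodule.span D (Set.range β) ≤ ⊤)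
      (by rw [finrank_top, hspan])
  have hmem (x : L) : LinearMap.lsmul D L c x ∈ Submodule.span D (Set.range β) :=
    hle (Submodule.smul_mem_pointwise_smul x c ⊤ trivial)
  let B := Module.Basis.span hβ
  refine ⟨_, β, fun j => B.coord j ∘ₗ (LinearMap.lsmul D L c).codRestrict _ hmem, c, hβ,
    nonZeroDivisors.ne_zero hc, fun x => ?_⟩
  have hx := (congrArg Subtype.val (B.sum_repr ⟨_, hmem x⟩)).symm
  simp only [Submodule.coe_sum, Submodule.coe_smul, B, Module.Basis.span_apply] at hx
  exact hx

theorem exists_dual_apply_ne_zero {L : Type*} [AddCommGroup L] [Module D L] [Module.Finite D L]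
    [Module.IsTorsionFree D L] {x : L} (hx : x ≠ 0) : ∃ l : Module.Dual D L, l x ≠ 0 := by
  obtain ⟨n, β, π, c, -, hc, hsum⟩ := exists_smul_eq_sum_dual_smul D L
  by_contra! hπ
  exact smul_ne_zero hc hx (by rw [hsum]; exact Finset.sum_eq_zero fun j _ => by simp [hπ])

theorem exists_pow_mem_of_smul_le_mul_self [IsNoetherianRing D] {J : Ideal D} (hJ : J ≠ ⊥) {γ : D}
    (h : γ • J ≤ J * J) : ∃ n : ℕ, γ ^ n ∈ J := by
  rcases eq_or_ne γ 0 with rfl | hγ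
  · exact ⟨1, by simp⟩
  let Dγ := Localization.Away γ
  have hpow : Submonoid.powers γ ≤ D⁰ := powers_le_nonZeroDivisors_of_noZeroDivisors hγ
  have : IsDomain Dγ := IsLocalization.isDomain_localization hpow
  have : IsNoetherianRing Dγ := IsLocalization.isNoetherianRing (.powers γ) Dγ inferInstance
  have hinj : Function.Injective (algebraMap D Dγ) := IsLocalization.injective Dγ hpow
  have hidem : IsIdempotentElem (J.map (algebraMap D Dγ)) := by
    refine le_antisymm Ideal.mul_le_left (Ideal.map_le_iff_le_comap.mpr fun s hs => ?_)
    have hmem : algebraMap D Dγ γ * algebraMap D Dγ s ∈ (J * J).map (algebraMap D Dγ) := by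
      rw [← map_mul]
      exact Ideal.mem_map_of_mem _ (h (Submodule.smul_mem_pointwise_smul s γ J hs))
    rw [Ideal.map_mul] at hmem
    have hunit : IsUnit (algebraMap D Dγ γ) := IsLocalization.Away.algebraMap_isUnit γ
    exact (Ideal.unit_mul_mem_iff_mem _ hunit).mp hmem
  rcases (Ideal.isIdempotentElem_iff_eq_bot_or_top _ (IsNoetherian.noetherian _)).mp hidem
    with hbot | htop
  · exact absurd ((Ideal.map_eq_bot_iff_of_injective hinj).mp hbot) hJ
  · obtain ⟨_, ⟨n, rfl⟩, hmem⟩ := Set.not_disjoint_iff.mp fun hdisj =>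
      (IsLocalization.map_algebraMap_ne_top_iff_disjoint (.powers γ) Dγ J).mpr hdisj htop
    exact ⟨n, hmem⟩

end Domain

/-! ### The submodules `C_{≥ n} N` -/

namespace CartierAction

section ActSpan

variable {p : ℕ} {R : Type u} [CommRing R] {C : CartierAlgebra.{u, v} p R}
  {M : Type x} [AddCommGroup M] [Module R M] (A : CartierAction C M)

/-- The submodule `C_{≥ n} N`, where `C_{≥ n} = ⨁_{e ≥ n} Cₑ`; thus `A.plus = A.actSpan 1`. -/
def actSpan (n : ℕ) (N : Submodule R M) : Submodule R M :=
  Submodule.span R {y | ∃ e : ℕ, n ≤ e ∧ ∃ κ : C.gr e, ∃ m ∈ N, A.act κ m = y}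

variable {A} in
theorem act_mem_actSpan {n e : ℕ} (h : n ≤ e) (κ : C.gr e) {N : Submodule R M} {m : M}
    (hm : m ∈ N) : A.act κ m ∈ A.actSpan n N :=
  Submodule.subset_span ⟨e, h, κ, m, hm, rfl⟩

variable {A} in
theorem actSpan_le_iff {n : ℕ} {N N' : Submodule R M} :
    A.actSpan n N ≤ N' ↔ ∀ e, n ≤ e → ∀ κ : C.gr e, ∀ m ∈ N, A.act κ m ∈ N' := by
  refine ⟨fun h e he κ m hm => h (act_mem_actSpan he κ hm), fun h => Submodule.span_le.mpr ?_⟩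
  rintro _ ⟨e, he, κ, m, hm, rfl⟩
  exact h e he κ m hm

theorem actSpan_mono (n : ℕ) : Monotone (A.actSpan n) := fun _ _ h =>
  actSpan_le_iff.mpr fun _ he κ _ hm => act_mem_actSpan he κ (h hm)

theorem plus_mono : Monotone A.plus := A.actSpan_mono 1

theorem actSpan_antitone (N : Submodule R M) : Antitone fun n => A.actSpan n N := fun _ _ h =>
  actSpan_le_iff.mpr fun _ he κ _ hm => act_mem_actSpan (h.trans he) κ hm

theorem le_actSpan_zero (N : Submodule R M) : N ≤ A.actSpan 0 N := fun m hm => by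
  simpa only [A.act_ofR, one_smul] using act_mem_actSpan (A := A) le_rfl (C.ofR 1) hm

variable {A} in
theorem act_mem_actSpan_add {n d : ℕ} (κ : C.gr d) {N : Submodule R M} {y : M}
    (hy : y ∈ A.actSpan n N) : A.act κ y ∈ A.actSpan (d + n) N := by
  induction hy using Submodule.span_induction generalizing d with
  | mem y hy =>
    obtain ⟨e, he, lam, m, hm, rfl⟩ := hy
    rw [← A.act_mul rfl]
    exact act_mem_actSpan (Nat.add_le_add_left he d) _ hm
  | zero => rw [map_zero]; exact zero_mem _
  | add y z _ _ h₁ h₂ => rw [map_add]; exact add_mem (h₁ κ) (h₂ κ)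
  | smul r y _ h => rw [← A.act_smul_left]; exact h _

theorem actSpan_actSpan_le (m n : ℕ) (N : Submodule R M) :
    A.actSpan m (A.actSpan n N) ≤ A.actSpan (m + n) N :=
  actSpan_le_iff.mpr fun _ he κ _ hy =>
    A.actSpan_antitone N (Nat.add_le_add_right he n) (act_mem_actSpan_add κ hy)

theorem plus_iterate_le_actSpan (n : ℕ) (N : Submodule R M) : A.plus^[n] N ≤ A.actSpan n N := by
  induction n with
  | zero => exact A.le_actSpan_zero N
  | succ n ih =>
    rw [Function.iterate_succ_apply', Nat.add_comm]
    exact (A.plus_mono ih).trans (A.actSpan_actSpan_le 1 n N)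

variable {A}

theorem isCartierSubmodule_iff {N : Submodule R M} :
    A.IsCartierSubmodule N ↔ A.actSpan 0 N ≤ N := by
  simp only [actSpan_le_iff, zero_le, true_imp_iff, IsCartierSubmodule]

theorem isCartierSubmodule_actSpan (n : ℕ) (N : Submodule R M) :
    A.IsCartierSubmodule (A.actSpan n N) :=
  isCartierSubmodule_iff.mpr ((A.actSpan_actSpan_le 0 n N).trans_eq (by rw [Nat.zero_add]))

theorem IsCartierSubmodule.actSpan_le {N : Submodule R M} (hN : A.IsCartierSubmodule N) (n : ℕ) :
    A.actSpan n N ≤ N :=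
  actSpan_le_iff.mpr fun e _ => hN e

theorem IsCartierSubmodule.plus_iterate_antitone {N : Submodule R M}
    (hN : A.IsCartierSubmodule N) : Antitone fun n => A.plus^[n] N :=
  A.plus_mono.antitone_iterate_of_map_le (hN.actSpan_le 1)

theorem IsCartierSubmodule.iSup {ι : Sort*} {N : ι → Submodule R M}
    (hN : ∀ i, A.IsCartierSubmodule (N i)) : A.IsCartierSubmodule (⨆ i, N i) := by
  intro e κ m hm
  induction hm using Submodule.iSup_induction' with
  | mem i x hx => exact Submodule.mem_iSup_of_mem i (hN i e κ x hx)
  | zero => rw [map_zero]; exact zero_mem _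
  | add x y _ _ hx hy => rw [map_add]; exact add_mem hx hy

theorem isCartierSubmodule_torsionBySet (I : Ideal R) (hp : p ≠ 0) :
    A.IsCartierSubmodule (Submodule.torsionBySet R M I) := by
  intro e κ m hm
  rw [Submodule.mem_torsionBySet_iff] at hm ⊢
  intro a
  rw [← A.act_pow_smul, hm ⟨_, I.pow_mem_of_mem a.2 _ (pow_pos (Nat.pos_of_ne_zero hp) e)⟩,
    map_zero]

end ActSpan

section ScalarMultiplication

variable {p : ℕ} [Fact p.Prime] {R : Type u} [CommRing R] {C : CartierAlgebra.{u, v} p R}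
  {M : Type x} [AddCommGroup M] [Module R M] {A : CartierAction C M}

theorem smul_actSpan_le {k n : ℕ} (h : k ≤ p ^ n) (c : R) (N : Submodule R M) :
    c • A.actSpan n N ≤ A.actSpan n (c ^ k • N) := by
  suffices A.actSpan n N ≤ (A.actSpan n (c ^ k • N)).comap (LinearMap.lsmul R M c) from
    Submodule.map_le_iff_le_comap.mpr this
  refine actSpan_le_iff.mpr fun e he κ m hm => ?_
  have hk : k ≤ p ^ e := h.trans (Nat.pow_le_pow_right (Fact.out : p.Prime).pos he)
  rw [Submodule.mem_comap, LinearMap.lsmul_apply, ← A.act_pow_smul, ← Nat.add_sub_cancel' hk,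
    pow_add, mul_smul]
  exact act_mem_actSpan he κ (Submodule.smul_mem_pointwise_smul _ _ _ (N.smul_mem _ hm))

theorem smul_plus_iterate_le (n : ℕ) (c : R) (N : Submodule R M) :
    c • A.plus^[n] N ≤ A.plus^[n] (c • N) :=
  A.plus_mono.le_iterate_comp_of_le (h := (c • ·)) (g := A.plus) (fun N' => by
    have h := smul_actSpan_le (A := A) (Nat.one_le_pow 1 p (Fact.out : p.Prime).pos) c N'
    rwa [pow_one] at h) n N

theorem pow_smul_le_plus_iterate {Q : Submodule R M} {c : R} (h : c • Q ≤ A.plus Q) :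
    ∀ n, c ^ n • Q ≤ A.plus^[n] Q
  | 0 => by simp
  | n + 1 => calc
      c ^ (n + 1) • Q = c • c ^ n • Q := by rw [pow_succ', mul_smul]
      _ ≤ c • A.plus^[n] Q := smul_mono_right c (pow_smul_le_plus_iterate h n)
      _ ≤ A.plus^[n] (c • Q) := smul_plus_iterate_le n c Q
      _ ≤ A.plus^[n] (A.plus Q) := A.plus_mono.iterate n h

/-- The exponent `3` does not depend on `k`: the submodule `c ^ 2 • Q` is contained in
`C_{≥ k} (c ^ 2 • Q)`, and multiplication by `c` on `C_{≥ k} Q` becomes multiplication by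
`c ^ p ^ e` with `p ^ e ≥ k` on `Q`. -/
theorem IsCartierSubmodule.pow_three_smul_le {Q N : Submodule R M} {c : R} (h : c • Q ≤ A.plus Q)
    (hN : A.IsCartierSubmodule N) {k : ℕ} (hk : c ^ k • Q ≤ N) : c ^ 3 • Q ≤ N := by
  have hp : 1 < p := (Fact.out : p.Prime).one_lt
  have hplus : c ^ 2 • Q ≤ A.plus (c ^ 2 • Q) := calc
    c ^ 2 • Q = c • c • Q := by rw [sq, mul_smul]
    _ ≤ c • A.plus Q := smul_mono_right c h
    _ ≤ A.plus (c ^ 2 • Q) := smul_actSpan_le (by rwa [pow_one]) c Q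
  have hactSpan : c ^ 2 • Q ≤ A.actSpan k (c ^ 2 • Q) :=
    (A.plus_mono.monotone_iterate_of_le_map hplus k.zero_le).trans (A.plus_iterate_le_actSpan k _)
  calc c ^ 3 • Q = c • c ^ 2 • Q := by rw [pow_succ', mul_smul]
    _ ≤ c • A.actSpan k (c ^ 2 • Q) := smul_mono_right c hactSpan
    _ ≤ A.actSpan k (c ^ k • c ^ 2 • Q) := smul_actSpan_le (Nat.lt_pow_self hp).le c _
    _ = A.actSpan k (c ^ 2 • c ^ k • Q) := by rw [smul_comm]
    _ ≤ A.actSpan k N := A.actSpan_mono k <|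
        (smul_mono_right (c ^ 2) hk).trans (Submodule.smul_le_self_of_tower (c ^ 2) N)
    _ ≤ N := hN.actSpan_le k

theorem actSpan_saturation_le (n : ℕ) (W : Submonoid R) (N : Submodule R M) :
    A.actSpan n (saturation W N) ≤ saturation W (A.actSpan n N) := by
  refine actSpan_le_iff.mpr fun e he κ m ⟨c, hc, hm⟩ => ⟨c, hc, ?_⟩
  rw [← A.act_pow_smul, ← Nat.sub_add_cancel (Nat.one_le_pow e p (Fact.out : p.Prime).pos),
    pow_succ, mul_smul]
  exact act_mem_actSpan he κ (N.smul_mem _ hm)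

theorem plus_iterate_saturation_le (n : ℕ) (W : Submonoid R) (N : Submodule R M) :
    A.plus^[n] (saturation W N) ≤ saturation W (A.plus^[n] N) :=
  A.plus_mono.iterate_comp_le_of_le (h := saturation W) (g := A.plus)
    (actSpan_saturation_le 1 W) n N

theorem isCartierSubmodule_saturation {N : Submodule R M} (hN : A.IsCartierSubmodule N)
    (W : Submonoid R) : A.IsCartierSubmodule (saturation W N) :=
  isCartierSubmodule_iff.mpr <| (actSpan_saturation_le 0 W N).trans <|
    saturation_mono (hN.actSpan_le 0)

end ScalarMultiplication

end CartierAction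

/-! ### The test family in terms of torsion -/

section Pullback

variable {p : ℕ} [Fact p.Prime] {R : Type u} [CommRing R] [CharP R p]
  {C : CartierAlgebra.{u, v} p R} {S : Type w} [CommRing S] [Algebra R S]

variable (C S) in
/-- The canonical map `C → f^* C`, `κ ↦ κ ⊗ 1`. -/
def CartierAlgebra.toPullback {e : ℕ} (κ : C.gr e) : (C.pullback S).gr e :=
  (1 ⊗ₜ[R] κ : S ⊗[R] C.gr e)

variable {M : Type x} [AddCommGroup M] [Module S M] {A : CartierAction (C.pullback S) M}

theorem CartierAction.act_pullback_mem {e : ℕ} {N N' : Submodule S M}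
    (h : ∀ κ : C.gr e, ∀ m ∈ N, A.act (C.toPullback S κ) m ∈ N') (κ : (C.pullback S).gr e)
    {m : M} (hm : m ∈ N) : A.act κ m ∈ N' := by
  let actm : S ⊗[R] C.gr e →+ M := A.act.flip m
  change actm κ ∈ N'
  induction κ using TensorProduct.induction_on with
  | zero => rw [map_zero]; exact zero_mem _
  | add κ κ' hκ hκ' => rw [map_add]; exact add_mem hκ hκ'
  | tmul s κ =>
    have hs : (s ⊗ₜ[R] κ : S ⊗[R] C.gr e) = s • C.toPullback S κ := by
      rw [CartierAlgebra.toPullback]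
      exact (congrArg (· ⊗ₜ[R] κ) (mul_one s).symm).trans (TensorProduct.smul_tmul' s 1 κ).symm
    rw [hs]
    exact (A.act_smul_left s _ m).symm ▸ h κ _ (N.smul_mem s hm)

theorem CartierAction.actSpan_pullback_le_iff {n : ℕ} {N N' : Submodule S M} :
    A.actSpan n N ≤ N' ↔
      ∀ e, n ≤ e → ∀ κ : C.gr e, ∀ m ∈ N, A.act (C.toPullback S κ) m ∈ N' :=
  ⟨fun h e he _ => actSpan_le_iff.mp h e he _, fun h =>
    actSpan_le_iff.mpr fun e he κ _ hm => act_pullback_mem (h e he) κ hm⟩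

end Pullback

theorem localized_le_iff {R : Type*} [CommRing R] {M : Type*} [AddCommGroup M] [Module R M]
    {W : Submonoid R} {N : Submodule R M} {P : Submodule (Localization W) (LocalizedModule W M)} :
    N.localized W ≤ P ↔ ∀ m ∈ N, LocalizedModule.mk m 1 ∈ P := by
  rw [Submodule.localized, Submodule.localized'_eq_span, Submodule.span_le,
    Set.image_subset_iff]
  rfl

theorem torsionBySet_map_localization {R : Type*} [CommRing R] {M : Type*} [AddCommGroup M]
    [Module R M] (W : Submonoid R) {I : Ideal R} (hI : I.FG) :
    Submodule.torsionBySet (Localization W) (LocalizedModule W M)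
        ((I.map (algebraMap R (Localization W)) : Ideal (Localization W))) =
      (Submodule.torsionBySet R M I).localized W := by
  rw [Ideal.map, ← Submodule.torsionBySet_eq_torsionBySet_span]
  ext y
  induction y using LocalizedModule.induction_on with | h m s => ?_
  let ann : Submodule R M := Submodule.map (LinearMap.toSpanSingleton R M m) I
  have hmk (a : R) : algebraMap R (Localization W) a • LocalizedModule.mk m s = 0 ↔
      a • m ∈ saturation W ⊥ := by
    rw [algebraMap_smul, LocalizedModule.smul'_mk, ← mk_mem_localized_iff (s := s),
      Submodule.localized, Submodule.localized'_bot, Submodule.mem_bot]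
  calc LocalizedModule.mk m s ∈ Submodule.torsionBySet (Localization W) (LocalizedModule W M)
        (algebraMap R (Localization W) '' I)
    _ ↔ ann ≤ saturation W ⊥ := by
      simp only [ann, Submodule.map_le_iff_le_comap, Submodule.mem_torsionBySet_iff, Subtype.forall,
        Set.forall_mem_image, hmk]
      rfl
    _ ↔ ∃ c ∈ W, c • ann ≤ ⊥ :=
      ⟨exists_smul_le_of_le_saturation (Submodule.FG.map _ hI),
        fun ⟨_, hc, h⟩ => le_saturation_of_smul_le hc h⟩
    _ ↔ LocalizedModule.mk m s ∈ (Submodule.torsionBySet R M I).localized W := by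
      rw [mk_mem_localized_iff]
      refine exists_congr fun c => and_congr_right fun _ => ?_
      simp only [ann, Submodule.pointwise_smul_def, Submodule.map_le_iff_le_comap,
        Submodule.mem_torsionBySet_iff, Subtype.forall]
      exact forall₂_congr fun a _ => (smul_comm c a m).congr_left

section LocalCohomologyZero

variable {R : Type*} [CommRing R] {M : Type*} [AddCommGroup M] [Module R M]

theorem torsionBySet_inf_le_localCohomologyZero (I : Ideal R) (N : Submodule R M) :
    Submodule.torsionBySet R M I ⊓ N ≤ localCohomologyZero I N := fun m hm =>
  ⟨hm.2, 1, fun a ha => (Submodule.mem_torsionBySet_iff _ _).mp hm.1 ⟨a, by rwa [← pow_one I]⟩⟩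

theorem exists_localCohomologyZero_le_torsionBySet_pow [IsNoetherian R M] (I : Ideal R)
    (N : Submodule R M) :
    ∃ k : ℕ, localCohomologyZero I N ≤ Submodule.torsionBySet R M (I ^ k : Ideal R) := by
  obtain ⟨s, hs⟩ := IsNoetherian.noetherian (localCohomologyZero I N)
  choose! k hk using fun m (hm : m ∈ s) =>
    (hs ▸ Submodule.subset_span hm : m ∈ localCohomologyZero I N).2
  refine ⟨s.sup k, hs ▸ Submodule.span_le.mpr fun m hm => ?_⟩
  exact (Submodule.mem_torsionBySet_iff _ _).mpr fun a =>
    hk m hm a (Ideal.pow_le_pow_right (Finset.le_sup hm) a.2)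

end LocalCohomologyZero

namespace CartierAction

section Localization

variable {p : ℕ} [Fact p.Prime] {R : Type u} [CommRing R] [CharP R p]
  {C : CartierAlgebra.{u, v} p R} {M : Type x} [AddCommGroup M] [Module R M]
  (A : CartierAction C M) (W : Submonoid R)

theorem localization_act_toPullback_mk {e : ℕ} (κ : C.gr e) (m : M) (t : W) :
    (A.localization W).act (C.toPullback (Localization W) κ) (LocalizedModule.mk m (t ^ p ^ e)) =
      LocalizedModule.mk (A.act κ m) t :=
  (congrArg (A.locFun W κ) (one_smul _ _)).trans (A.locFun_mk_pow W κ m t)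

theorem actSpan_localized (n : ℕ) (N : Submodule R M) :
    (A.localization W).actSpan n (N.localized W) = (A.actSpan n N).localized W := by
  refine le_antisymm (actSpan_pullback_le_iff.mpr fun e he κ y hy => ?_)
    (localized_le_iff.mpr fun m hm => ?_)
  · obtain ⟨m, t, rfl⟩ := exists_mk_pow (p := p) W e y
    rw [mk_mem_localized_iff] at hy
    rw [localization_act_toPullback_mk, mk_mem_localized_iff]
    exact actSpan_saturation_le n W N (act_mem_actSpan he κ hy)
  · suffices A.actSpan n N ≤ (((A.localization W).actSpan n (N.localized W)).restrictScalars
        R).comap (LocalizedModule.mkLinearMap W M) from this hm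
    refine actSpan_le_iff.mpr fun e he κ m hm => ?_
    have hmk := A.localization_act_toPullback_mk W κ m 1
    rw [one_pow] at hmk
    change LocalizedModule.mk (A.act κ m) 1 ∈ (A.localization W).actSpan n (N.localized W)
    rw [← hmk]
    exact act_mem_actSpan he _ (mk_mem_localized_iff.mpr (le_saturation hm))

theorem plus_iterate_localized (n : ℕ) (N : Submodule R M) :
    (A.localization W).plus^[n] (N.localized W) = (A.plus^[n] N).localized W :=
  (Function.Semiconj.iterate_right (f := fun N : Submodule R M => N.localized W)
    (fun N => (A.actSpan_localized W 1 N).symm) n N).symm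

end Localization

section NilAt

variable {p : ℕ} {R : Type u} [CommRing R] {C : CartierAlgebra.{u, v} p R}
  {M : Type x} [AddCommGroup M] [Module R M] {A : CartierAction C M}

variable (A) in
/-- `C₊ ^ n` maps the `η`-torsion `M[η]` into `N_η` for some `n`. By `mem_testFamily_iff` this is
the local condition at `η` in the definition of the test module. -/
def IsNilAt (η : Ideal R) [η.IsPrime] (N : Submodule R M) : Prop :=
  ∃ n : ℕ, A.plus^[n] (Submodule.torsionBySet R M η) ≤ saturation η.primeCompl N

theorem IsNilAt.mono {η : Ideal R} [η.IsPrime] {N N' : Submodule R M} (hN : N ≤ N')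
    (h : A.IsNilAt η N) : A.IsNilAt η N' :=
  h.imp fun _ h => h.trans (saturation_mono hN)

variable [Fact p.Prime]

/-- An element of `H⁰_I` is killed by `I ^ p ^ e` for large `e`, so its image under `Cₑ` is killed
by `I`. -/
theorem exists_plus_iterate_localCohomologyZero_le [IsNoetherian R M] (A : CartierAction C M)
    (I : Ideal R) (N : Submodule R M) :
    ∃ k : ℕ, A.plus^[k] (localCohomologyZero I N) ≤ Submodule.torsionBySet R M I := by
  obtain ⟨k, hk⟩ := exists_localCohomologyZero_le_torsionBySet_pow I N
  refine ⟨k, (A.plus_iterate_le_actSpan k _).trans (actSpan_le_iff.mpr fun e he κ m hm => ?_)⟩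
  rw [Submodule.mem_torsionBySet_iff]
  rintro ⟨a, ha⟩
  have hke : k ≤ p ^ e := he.trans (Nat.lt_pow_self (Fact.out : p.Prime).one_lt).le
  have hkm := (Submodule.mem_torsionBySet_iff _ _).mp (hk hm)
    ⟨a ^ p ^ e, Ideal.pow_le_pow_right hke (Ideal.pow_mem_pow ha _)⟩
  change a • A.act κ m = 0
  rw [← A.act_pow_smul, hkm, map_zero]

variable [CharP R p] [IsNoetherianRing R] [Module.Finite R M]

theorem isNilIsoInclusion_iff_isNilAt (η : Ideal R) [η.IsPrime] (N : Submodule R M) :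
    (A.localization η.primeCompl).IsNilIsoInclusion
      (localCohomologyZero (η.map (algebraMap R (Localization.AtPrime η)))
        (N.localized η.primeCompl))
      (localCohomologyZero (η.map (algebraMap R (Localization.AtPrime η))) ⊤) ↔
    A.IsNilAt η N := by
  set I : Ideal (Localization.AtPrime η) := η.map (algebraMap R (Localization.AtPrime η))
  set A' := A.localization η.primeCompl
  have : Module.Finite (Localization.AtPrime η) (LocalizedModule η.primeCompl M) :=
    Module.Finite.of_isLocalizedModule η.primeCompl (LocalizedModule.mkLinearMap η.primeCompl M)
  have hiterate (n : ℕ) : A'.plus^[n] (Submodule.torsionBySet _ _ I) =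
      (A.plus^[n] (Submodule.torsionBySet R M η)).localized η.primeCompl := by
    rw [torsionBySet_map_localization _ (IsNoetherian.noetherian η)]
    exact A.plus_iterate_localized η.primeCompl n _
  constructor
  · rintro ⟨-, n, hn⟩
    refine ⟨n, localized_le_localized_iff.mp ?_⟩
    rw [← hiterate]
    have htorsion : Submodule.torsionBySet (Localization.AtPrime η)
        (LocalizedModule η.primeCompl M) I ≤ localCohomologyZero I ⊤ :=
      fun m hm => torsionBySet_inf_le_localCohomologyZero I ⊤ ⟨hm, trivial⟩
    exact (A'.plus_mono.iterate n htorsion).trans (hn.trans fun _ h => h.1)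
  · rintro ⟨n, hn⟩
    obtain ⟨k, hk⟩ := exists_plus_iterate_localCohomologyZero_le A' I ⊤
    refine ⟨fun m hm => ⟨trivial, hm.2⟩, n + k, ?_⟩
    rw [Function.iterate_add_apply]
    refine (A'.plus_mono.iterate n hk).trans
      ((le_inf ?_ ?_).trans (torsionBySet_inf_le_localCohomologyZero I _))
    · exact (isCartierSubmodule_torsionBySet I (Fact.out : p.Prime).ne_zero).plus_iterate_antitone
        n.zero_le
    · exact (hiterate n).trans_le (localized_le_localized_iff.mpr hn)

theorem mem_testFamily_iff {N : Submodule R M} :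
    N ∈ A.testFamily ↔ A.IsCartierSubmodule N ∧
      ∀ (η : Ideal R) [η.IsPrime], η ∈ associatedPrimes R M → A.IsNilAt η N := by
  simp only [testFamily, Set.mem_ofPred_eq, isNilIsoInclusion_iff_isNilAt]

end NilAt

end CartierAction

/-! ### Submodules of `M` and of `f^! M` -/

namespace UpperShriek

section

variable {R : Type u} {S : Type w} {M : Type x} [CommRing R] [CommRing S] [Algebra R S]
  [AddCommGroup M] [Module R M]

theorem algebraMap_smul_apply (r : R) (μ : UpperShriek R S M) (s : S) :
    (algebraMap R S r • μ) s = r • μ s := by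
  rw [smul_apply, ← Algebra.smul_def, map_smul]

instance [IsNoetherianRing R] [Module.Finite R S] [Module.Finite R M] :
    Module.Finite S (UpperShriek R S M) := by
  have : Module.Finite R (UpperShriek R S M) := inferInstanceAs (Module.Finite R (S →ₗ[R] M))
  exact Module.Finite.of_restrictScalars_finite R S _

variable (S) in
/-- The submodule `f^! N = Hom_R(S, N)` of `f^! M`. -/
def submodule (N : Submodule R M) : Submodule S (UpperShriek R S M) where
  carrier := {μ | ∀ s, μ s ∈ N}
  zero_mem' _ := N.zero_mem
  add_mem' h h' s := N.add_mem (h s) (h' s)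
  smul_mem' t _ h s := h (t * s)

theorem submodule_mono : Monotone (submodule (M := M) (R := R) S) := fun _ _ h _ hμ s => h (hμ s)

/-- The image `Tr_M (f_* N')` of a submodule under the trace. -/
def traceImage (N' : Submodule S (UpperShriek R S M)) : Submodule R M :=
  (N'.restrictScalars R).map (trace R S M)

theorem mem_traceImage {N' : Submodule S (UpperShriek R S M)} {m : M} :
    m ∈ traceImage N' ↔ ∃ μ ∈ N', μ 1 = m := Iff.rfl

theorem gc_traceImage_submodule :
    GaloisConnection (traceImage (R := R) (S := S) (M := M)) (submodule S) := by
  refine fun N' N => ⟨fun h μ hμ s => ?_, ?_⟩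
  · exact h (mem_traceImage.mpr ⟨s • μ, N'.smul_mem s hμ, by rw [smul_apply, mul_one]⟩)
  · rintro h _ ⟨μ, hμ, rfl⟩
    exact h hμ 1

theorem torsionBySet_le_submodule (ξ : Ideal S) :
    Submodule.torsionBySet S (UpperShriek R S M) ξ ≤
      submodule S (Submodule.torsionBySet R M (ξ.under R)) := by
  intro μ hμ s
  rw [Submodule.mem_torsionBySet_iff] at hμ ⊢
  rintro ⟨a, ha⟩
  exact (algebraMap_smul_apply a μ s).symm.trans
    (DFunLike.congr_fun (hμ ⟨algebraMap R S a, ha⟩) s)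

end

end UpperShriek

namespace CartierAction

section UpperShriek

open UpperShriek

variable {p : ℕ} [Fact p.Prime] {R : Type u} [CommRing R] [CharP R p]
  {C : CartierAlgebra.{u, v} p R} {M : Type x} [AddCommGroup M] [Module R M]
  (A : CartierAction C M) (S : Type w) [CommRing S] [Algebra R S]

theorem upperShriek_act_toPullback_apply {e : ℕ} (κ : C.gr e) (μ : UpperShriek R S M) (s : S) :
    (A.upperShriek S).act (C.toPullback S κ) μ s = A.act κ (μ (s ^ p ^ e)) := by
  change A.act κ (μ (1 * s ^ p ^ e)) = _
  rw [one_mul]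

theorem act_traceImage_mem {e : ℕ} {N' : Submodule S (UpperShriek R S M)} (κ : C.gr e) {m : M}
    (hm : m ∈ traceImage N') :
    ∃ μ ∈ N', (A.upperShriek S).act (C.toPullback S κ) μ 1 = A.act κ m := by
  obtain ⟨μ, hμ, rfl⟩ := hm
  exact ⟨μ, hμ, by rw [upperShriek_act_toPullback_apply, one_pow]; rfl⟩

theorem actSpan_submodule_le (n : ℕ) (N : Submodule R M) :
    (A.upperShriek S).actSpan n (submodule S N) ≤ submodule S (A.actSpan n N) :=
  actSpan_pullback_le_iff.mpr fun e he κ μ hμ s => by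
    rw [upperShriek_act_toPullback_apply]
    exact act_mem_actSpan he κ (hμ _)

theorem actSpan_traceImage_le (n : ℕ) (N' : Submodule S (UpperShriek R S M)) :
    A.actSpan n (traceImage N') ≤ traceImage ((A.upperShriek S).actSpan n N') := by
  refine actSpan_le_iff.mpr fun e he κ m hm => ?_
  obtain ⟨μ, hμ, hκ⟩ := A.act_traceImage_mem S κ hm
  exact hκ ▸ mem_traceImage.mpr ⟨_, act_mem_actSpan he _ hμ, rfl⟩

theorem plus_iterate_submodule_le (n : ℕ) (N : Submodule R M) :
    (A.upperShriek S).plus^[n] (submodule S N) ≤ submodule S (A.plus^[n] N) := by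
  induction n with
  | zero => exact le_rfl
  | succ n ih =>
    rw [Function.iterate_succ_apply', Function.iterate_succ_apply']
    exact ((A.upperShriek S).plus_mono ih).trans (A.actSpan_submodule_le S 1 _)

theorem plus_iterate_traceImage_le (n : ℕ) (N' : Submodule S (UpperShriek R S M)) :
    A.plus^[n] (traceImage N') ≤ traceImage ((A.upperShriek S).plus^[n] N') := by
  induction n with
  | zero => exact le_rfl
  | succ n ih =>
    rw [Function.iterate_succ_apply', Function.iterate_succ_apply']
    exact (A.plus_mono ih).trans (A.actSpan_traceImage_le S 1 _)

variable {A S}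

theorem IsCartierSubmodule.submodule {N : Submodule R M} (hN : A.IsCartierSubmodule N) :
    (A.upperShriek S).IsCartierSubmodule (submodule S N) :=
  isCartierSubmodule_iff.mpr <| (A.actSpan_submodule_le S 0 N).trans <|
    submodule_mono (hN.actSpan_le 0)

theorem IsCartierSubmodule.traceImage {N' : Submodule S (UpperShriek R S M)}
    (hN' : (A.upperShriek S).IsCartierSubmodule N') : A.IsCartierSubmodule (traceImage N') :=
  isCartierSubmodule_iff.mpr <| (A.actSpan_traceImage_le S 0 N').trans <|
    gc_traceImage_submodule.monotone_l (hN'.actSpan_le 0)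

end UpperShriek

end CartierAction

section LiesOver

open UpperShriek

variable {R : Type u} [CommRing R] {S : Type w} [CommRing S] [Algebra R S] [Module.Finite R S]
  {M : Type x} [AddCommGroup M] [Module R M]
  (η : Ideal R) (ξ : Ideal S) [η.IsPrime] [ξ.IsPrime] [ξ.LiesOver η]

theorem submodule_saturation_le (N : Submodule R M) :
    submodule S (saturation η.primeCompl N) ≤ saturation ξ.primeCompl (submodule S N) := by
  intro μ hμ
  obtain ⟨c, hc, hle⟩ := exists_smul_le_of_le_saturation
    (Module.Finite.iff_fg.mp (Module.Finite.range (μ : S →ₗ[R] M)))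
    (LinearMap.range_le_iff_comap.mpr (eq_top_iff.mpr fun s _ => hμ s))
  refine ⟨algebraMap R S c, fun h => hc ((ξ.mem_of_liesOver η c).mpr h), fun s => ?_⟩
  rw [algebraMap_smul_apply]
  exact hle (Submodule.smul_mem_pointwise_smul _ c _ ⟨s, rfl⟩)

theorem exists_mul_sub_algebraMap_mem {t : S} (ht : t ∉ ξ) :
    ∃ (s : S) (r : R), r ∉ η ∧ s * t - algebraMap R S r ∈ ξ := by
  have ht' : Ideal.Quotient.mk ξ t ≠ 0 := fun h => ht (Ideal.Quotient.eq_zero_iff_mem.mp h)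
  have halg : IsAlgebraic (R ⧸ η) (Ideal.Quotient.mk ξ t) :=
    (Algebra.IsIntegral.isIntegral (R := R ⧸ η) (Ideal.Quotient.mk ξ t)).isAlgebraic
  obtain ⟨r', hr', s', hs'⟩ := halg.exists_nonzero_dvd (mem_nonZeroDivisors_of_ne_zero ht')
  obtain ⟨r, rfl⟩ := Ideal.Quotient.mk_surjective r'
  obtain ⟨s, rfl⟩ := Ideal.Quotient.mk_surjective s'
  refine ⟨s, r, fun h => hr' (Ideal.Quotient.eq_zero_iff_mem.mpr h), ?_⟩
  rw [← Ideal.Quotient.eq_zero_iff_mem, map_sub, map_mul, mul_comm, ← hs', sub_eq_zero]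
  rfl

theorem traceImage_torsionBySet_inf_saturation_le (N' : Submodule S (UpperShriek R S M)) :
    traceImage (Submodule.torsionBySet S (UpperShriek R S M) ξ ⊓ saturation ξ.primeCompl N') ≤
      saturation η.primeCompl (traceImage N') := by
  rintro _ ⟨μ, ⟨hμξ, t, ht, htμ⟩, rfl⟩
  obtain ⟨s, r, hr, hsr⟩ := exists_mul_sub_algebraMap_mem η ξ ht
  have hμ : s • t • μ = algebraMap R S r • μ := by
    rw [← sub_eq_zero, ← mul_smul, ← sub_smul]
    exact (Submodule.mem_torsionBySet_iff _ _).mp hμξ ⟨_, hsr⟩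
  refine ⟨r, hr, mem_traceImage.mpr ⟨algebraMap R S r • μ, hμ ▸ N'.smul_mem s htμ, ?_⟩⟩
  exact algebraMap_smul_apply r μ 1

/-- A functional `l` on `S/ξ` over `R/η` with `l 1 = c ≠ 0` yields, for `m` killed by `η`, the map
`s ↦ l s • m` which is killed by `ξ` and has trace `c • m`. -/
theorem torsionBySet_le_saturation_traceImage :
    Submodule.torsionBySet R M η ≤ saturation η.primeCompl
      (traceImage (Submodule.torsionBySet S (UpperShriek R S M) ξ)) := by
  intro m hm
  have : Module.Finite (R ⧸ η) (S ⧸ ξ) := Module.Finite.of_restrictScalars_finite R (R ⧸ η) (S ⧸ ξ)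
  have : Module.IsTorsionFree (R ⧸ η) (S ⧸ ξ) :=
    Module.isTorsionFree_iff_faithfulSMul.mpr inferInstance
  obtain ⟨l, hl⟩ := exists_dual_apply_ne_zero (D := R ⧸ η) (one_ne_zero (α := S ⧸ ξ))
  obtain ⟨c, hc⟩ := Ideal.Quotient.mk_surjective (l 1)
  let toM : (R ⧸ η) →ₗ[R] M := Submodule.liftQ η (LinearMap.toSpanSingleton R M m) fun a ha =>
    (Submodule.mem_torsionBySet_iff _ _).mp hm ⟨a, ha⟩
  let μ : UpperShriek R S M :=
    (toM ∘ₗ l.restrictScalars R ∘ₗ (Ideal.Quotient.mkₐ R ξ).toLinearMap : S →ₗ[R] M)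
  have hμ (s : S) : μ s = toM (l (Ideal.Quotient.mk ξ s)) := rfl
  refine ⟨c, fun h => hl (hc ▸ Ideal.Quotient.eq_zero_iff_mem.mpr h),
    mem_traceImage.mpr ⟨μ, ?_, ?_⟩⟩
  · refine (Submodule.mem_torsionBySet_iff _ _).mpr fun t => UpperShriek.ext fun s => ?_
    change μ (t * s) = 0
    rw [hμ, map_mul, Ideal.Quotient.eq_zero_iff_mem.mpr t.2, zero_mul, map_zero, map_zero]
  · rw [hμ, map_one, ← hc]
    rfl

theorem mem_associatedPrimes_upperShriek [IsNoetherianRing R] (h : η ∈ associatedPrimes R M) :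
    ξ ∈ associatedPrimes S (UpperShriek R S M) := by
  have : IsNoetherianRing S := IsNoetherianRing.of_finite R S
  obtain ⟨-, m, hm⟩ := isAssociatedPrime_iff.mp h
  have hann (r : R) : r ∈ η ↔ r • m = 0 := by rw [hm, Submodule.mem_colon_singleton,
    Submodule.mem_bot]
  have hsat : m ∉ saturation η.primeCompl ⊥ := fun ⟨c, hc, hcm⟩ => hc ((hann c).mpr hcm)
  obtain ⟨c, hc, μ, hμ, hμm⟩ := torsionBySet_le_saturation_traceImage η ξ
    ((Submodule.mem_torsionBySet_iff _ _).mpr fun a => (hann a).mp a.2)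
  refine isAssociatedPrime_iff.mpr ⟨inferInstance, μ, ?_⟩
  ext t
  rw [Submodule.mem_colon_singleton]
  refine ⟨fun ht => (Submodule.mem_torsionBySet_iff _ _).mp hμ ⟨t, ht⟩, fun htμ => ?_⟩
  by_contra ht
  have hmem := traceImage_torsionBySet_inf_saturation_le η ξ ⊥
    (mem_traceImage.mpr ⟨μ, ⟨hμ, t, ht, htμ⟩, hμm⟩)
  rw [gc_traceImage_submodule.l_bot] at hmem
  exact hsat (saturation_le_saturation_iff.mpr le_rfl ⟨c, hc, hmem⟩)

theorem under_mem_associatedPrimes [IsNoetherianRing R] {ξ : Ideal S}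
    (h : ξ ∈ associatedPrimes S (UpperShriek R S M)) : ξ.under R ∈ associatedPrimes R M := by
  have : IsNoetherianRing S := IsNoetherianRing.of_finite R S
  obtain ⟨hξ, μ, hμ⟩ := isAssociatedPrime_iff.mp h
  have htorsion : μ ∈ Submodule.torsionBySet S (UpperShriek R S M) ξ := by
    rw [Submodule.mem_torsionBySet_iff, hμ]
    exact fun t => Submodule.mem_colon_singleton.mp t.2
  have hμsat : μ ∉ saturation ξ.primeCompl ⊥ := fun ⟨t, ht, htμ⟩ =>
    ht (hμ ▸ Submodule.mem_colon_singleton.mpr htμ)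
  obtain ⟨s, hs⟩ : ∃ s, μ s ∉ saturation (ξ.under R).primeCompl ⊥ := by
    by_contra! hcon
    obtain ⟨t, ht, htμ⟩ := submodule_saturation_le (ξ.under R) ξ ⊥ hcon
    exact hμsat ⟨t, ht, UpperShriek.ext htμ⟩
  refine isAssociatedPrime_iff.mpr ⟨inferInstance, μ s, ?_⟩
  ext r
  rw [Submodule.mem_colon_singleton]
  exact ⟨fun hr => (Submodule.mem_torsionBySet_iff _ _).mp
    (torsionBySet_le_submodule ξ htorsion s) ⟨r, hr⟩, fun hr => by_contra fun h => hs ⟨r, h, hr⟩⟩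

variable {p : ℕ} [Fact p.Prime] [CharP R p] {C : CartierAlgebra.{u, v} p R} {A : CartierAction C M}

theorem CartierAction.IsNilAt.submodule {N : Submodule R M} (h : A.IsNilAt η N) :
    (A.upperShriek S).IsNilAt ξ (UpperShriek.submodule S N) := by
  obtain ⟨n, hn⟩ := h
  have htorsion : Submodule.torsionBySet S (UpperShriek R S M) ξ ≤
      UpperShriek.submodule S (Submodule.torsionBySet R M η) :=
    ξ.over_def η ▸ torsionBySet_le_submodule ξ
  refine ⟨n, ?_⟩
  calc (A.upperShriek S).plus^[n] (Submodule.torsionBySet S (UpperShriek R S M) ξ)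
    _ ≤ (A.upperShriek S).plus^[n] (UpperShriek.submodule S (Submodule.torsionBySet R M η)) :=
      (A.upperShriek S).plus_mono.iterate n htorsion
    _ ≤ UpperShriek.submodule S (A.plus^[n] (Submodule.torsionBySet R M η)) :=
      A.plus_iterate_submodule_le S n _
    _ ≤ UpperShriek.submodule S (saturation η.primeCompl N) := submodule_mono hn
    _ ≤ saturation ξ.primeCompl (UpperShriek.submodule S N) := submodule_saturation_le η ξ N

theorem CartierAction.IsNilAt.traceImage {N' : Submodule S (UpperShriek R S M)}
    (h : (A.upperShriek S).IsNilAt ξ N') : A.IsNilAt η (UpperShriek.traceImage N') := by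
  obtain ⟨n, hn⟩ := h
  set T := Submodule.torsionBySet S (UpperShriek R S M) ξ
  have hT : (A.upperShriek S).plus^[n] T ≤ T ⊓ saturation ξ.primeCompl N' :=
    le_inf ((isCartierSubmodule_torsionBySet ξ (Fact.out : p.Prime).ne_zero).plus_iterate_antitone
      n.zero_le) hn
  refine ⟨n, ?_⟩
  calc A.plus^[n] (Submodule.torsionBySet R M η)
    _ ≤ A.plus^[n] (saturation η.primeCompl (UpperShriek.traceImage T)) :=
      A.plus_mono.iterate n (torsionBySet_le_saturation_traceImage η ξ)
    _ ≤ saturation η.primeCompl (A.plus^[n] (UpperShriek.traceImage T)) :=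
      plus_iterate_saturation_le n _ _
    _ ≤ saturation η.primeCompl (UpperShriek.traceImage (T ⊓ saturation ξ.primeCompl N')) :=
      saturation_mono <| (A.plus_iterate_traceImage_le S n T).trans <|
        gc_traceImage_submodule.monotone_l hT
    _ ≤ saturation η.primeCompl (UpperShriek.traceImage N') :=
      saturation_le_saturation_iff.mpr (traceImage_torsionBySet_inf_saturation_le η ξ N')

end LiesOver

/-! ### Ranks over a domain -/

section Rank

theorem exists_le_succ (f : ℕ → ℕ) : ∃ n, f n ≤ f (n + 1) := by
  by_contra! h
  exact not_strictAnti_of_wellFoundedLT f (strictAnti_nat_of_succ_lt h)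

theorem exists_smul_le_succ_of_antitone {D : Type*} [CommRing D] [IsDomain D] {M : Type*}
    [AddCommGroup M] [Module D M] [IsNoetherian D M] {N : ℕ → Submodule D M} (hN : Antitone N) :
    ∃ n, ∃ c ∈ D⁰, c • N n ≤ N (n + 1) := by
  obtain ⟨n, hn⟩ := exists_le_succ fun n => Module.finrank D (N n)
  exact ⟨n, exists_smul_le_of_le_saturation (IsNoetherian.noetherian _)
    (le_saturation_of_finrank_le (hN n.le_succ) hn)⟩

variable {K L : Type*} [CommRing K] [IsDomain K] [CommRing L]

theorem finrank_upperShriek_le [IsNoetherianRing K] [Algebra K L] [Module.Finite K L]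
    [FaithfulSMul K L] (P : Type*) [AddCommGroup P] [Module K P] [Module.Finite K P] :
    Module.finrank L (UpperShriek K L P) ≤ Module.finrank K P := by
  have : Module.Finite K (UpperShriek K L P) := inferInstanceAs (Module.Finite K (L →ₗ[K] P))
  obtain ⟨n, β, π, c, hβ, hc, hβπ⟩ := exists_smul_eq_sum_dual_smul K L
  obtain ⟨r, w, ρ, d, hw, hd, hwρ⟩ := exists_smul_eq_sum_dual_smul K P
  obtain ⟨v, hv⟩ := exists_linearIndependent_of_le_finrank (R := L) (M := UpperShriek K L P) le_rfl
  have hn : 0 < n := by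
    refine Nat.pos_of_ne_zero fun hn => hc (FaithfulSMul.algebraMap_injective K L ?_)
    subst hn
    rw [map_zero, Algebra.algebraMap_eq_smul_one, hβπ, Fin.sum_univ_zero]
  let coords : UpperShriek K L P →ₗ[K] Fin n × Fin r → K :=
    LinearMap.pi fun ij => ρ ij.2 ∘ₗ LinearMap.applyₗ (R := K) (M₂ := P) (β ij.1)
  have hker : Module.finrank K (LinearMap.ker coords) = 0 := by
    refine Module.finrank_eq_zero_iff_isTorsion.mpr fun {μ} =>
      ⟨⟨d * c, mem_nonZeroDivisors_of_ne_zero (mul_ne_zero hd hc)⟩, Subtype.ext ?_⟩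
    have hρμ (i : Fin n) : d • μ.1 (β i) = 0 := by
      rw [hwρ]
      refine Finset.sum_eq_zero fun j _ => ?_
      have h : ρ j (μ.1 (β i)) = 0 := congrFun μ.2 (i, j)
      rw [h, zero_smul]
    refine UpperShriek.ext fun x => ?_
    calc (d * c) • μ.1 x = d • μ.1 (c • x) := by rw [mul_smul, map_smul]
      _ = 0 := by simp only [hβπ, map_sum, map_smul, Finset.smul_sum, smul_comm d, hρμ, smul_zero,
        Finset.sum_const_zero]
  have hle : n * Module.finrank L (UpperShriek K L P) ≤ n * r := calc
    n * Module.finrank L (UpperShriek K L P)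
    _ ≤ Module.finrank K (UpperShriek K L P) := by
      simpa using (linearIndependent_smul hβ hv).fintype_card_le_finrank
    _ = Module.finrank K (LinearMap.range coords) := by
      rw [← coords.quotKerEquivRange.finrank_eq, Submodule.finrank_quotient, hker, Nat.sub_zero]
    _ ≤ n * r := by simpa using (LinearMap.range coords).finrank_le
  exact (Nat.le_of_mul_le_mul_left hle hn).trans (by simpa using hw.fintype_card_le_finrank)

end Rank

namespace UpperShriek

section Coinduction

variable {K L V : Type*} [CommRing K] [CommRing L] [AddCommGroup V]

/-- `φ ↦ φ ∘ F` for a ring homomorphism `F : K → L`. The `L`-module of additive maps `L → V`, with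
`(t • φ) s = φ (t s)`, is encoded as `UpperShriek ℤ L V`. -/
def precomp (F : K →+* L) : UpperShriek ℤ L V →+ UpperShriek ℤ K V where
  toFun φ := (LinearMap.comp (φ : L →ₗ[ℤ] V) F.toAddMonoidHom.toIntLinearMap : K →ₗ[ℤ] V)
  map_zero' := rfl
  map_add' _ _ := rfl

@[simp]
theorem precomp_apply (F : K →+* L) (φ : UpperShriek ℤ L V) (s : K) :
    precomp F φ s = φ (F s) := rfl

theorem precomp_map_smul (F : K →+* L) (r : K) (φ : UpperShriek ℤ L V) :
    precomp F (F r • φ) = r • precomp F φ := by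
  ext s
  simp only [precomp_apply, smul_apply, map_mul]

/-- The additive maps `φ : L → V` such that `s ↦ φ (t F(s))` lies in `P` for all `t`; this is
`Hom_K(L, P)` for the `K`-algebra `L` given by `F`. -/
def coind (F : K →+* L) (P : Submodule K (UpperShriek ℤ K V)) :
    Submodule L (UpperShriek ℤ L V) where
  carrier := {φ | ∀ t : L, precomp F (t • φ) ∈ P}
  zero_mem' t := by rw [smul_zero, map_zero]; exact P.zero_mem
  add_mem' {φ ψ} h₁ h₂ t := by rw [smul_add, map_add]; exact P.add_mem (h₁ t) (h₂ t)
  smul_mem' c φ h t := by rw [smul_smul]; exact h _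

/-- The adjunction embedding of `coind F P` into `Hom_K(L, P)`, for an algebra structure with
structure map `F`. -/
def coindToUpperShriek [Algebra K L] (P : Submodule K (UpperShriek ℤ K V)) :
    coind (algebraMap K L) P →ₗ[L] UpperShriek K L P where
  toFun φ :=
    ({ toFun := fun t => ⟨precomp (algebraMap K L) (t • φ.1), φ.2 t⟩
       map_add' := fun s t => Subtype.ext (by simp only [add_smul, map_add, Submodule.coe_add])
       map_smul' := fun r t => Subtype.ext (by
        simp only [Algebra.smul_def, mul_smul, precomp_map_smul, RingHom.id_apply,
          Submodule.coe_smul]) } : L →ₗ[K] P)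
  map_add' φ ψ := by
    refine UpperShriek.ext fun t => Subtype.ext ?_
    exact (congrArg _ (smul_add t φ.1 ψ.1)).trans (map_add _ _ _)
  map_smul' c φ := by
    refine UpperShriek.ext fun t => Subtype.ext ?_
    refine congrArg (precomp (algebraMap K L)) ?_
    rw [Submodule.coe_smul, smul_smul, mul_comm]
    rfl

theorem coindToUpperShriek_injective [Algebra K L] (P : Submodule K (UpperShriek ℤ K V)) :
    Function.Injective (coindToUpperShriek (L := L) P) := by
  intro φ ψ h
  refine Subtype.ext (UpperShriek.ext fun t => ?_)
  have ht : precomp (algebraMap K L) (t • φ.1) = precomp (algebraMap K L) (t • ψ.1) :=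
    congrArg Subtype.val (DFunLike.congr_fun h t)
  simpa using DFunLike.congr_fun ht 1

end Coinduction

section CoinductionRank

variable {K L V : Type*} [CommRing K] [IsNoetherianRing K] [CommRing L] [AddCommGroup V]

theorem finite_coind {F : K →+* L} (hF : F.Finite) (P : Submodule K (UpperShriek ℤ K V))
    [Module.Finite K P] : Module.Finite L (coind F P) := by
  let : Algebra K L := F.toAlgebra
  have : Module.Finite K L := hF
  have : IsNoetherianRing L := IsNoetherianRing.of_finite K L
  have : Module.Finite K (UpperShriek K L P) := inferInstanceAs (Module.Finite K (L →ₗ[K] P))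
  have : Module.Finite L (UpperShriek K L P) := Module.Finite.of_restrictScalars_finite K L _
  exact Module.Finite.of_injective _ (coindToUpperShriek_injective (L := L) P)

theorem finrank_coind_le [IsDomain K] [Nontrivial L] {F : K →+* L} (hF : F.Finite)
    (hinj : Function.Injective F) (P : Submodule K (UpperShriek ℤ K V)) [Module.Finite K P] :
    Module.finrank L (coind F P) ≤ Module.finrank K P := by
  let : Algebra K L := F.toAlgebra
  have : Module.Finite K L := hF
  have : IsNoetherianRing L := IsNoetherianRing.of_finite K L
  have : FaithfulSMul K L := (faithfulSMul_iff_algebraMap_injective K L).mpr hinj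
  have : Module.Finite K (UpperShriek K L P) := inferInstanceAs (Module.Finite K (L →ₗ[K] P))
  have : Module.Finite L (UpperShriek K L P) := Module.Finite.of_restrictScalars_finite K L _
  exact (LinearMap.finrank_le_finrank_of_injective (coindToUpperShriek_injective (L := L) P)).trans
    (finrank_upperShriek_le P)

end CoinductionRank

theorem exists_smul_coind_le {K V : Type*} [CommRing K] [IsDomain K] [IsNoetherianRing K]
    [AddCommGroup V] {F : K →+* K} (hF : F.Finite) (hinj : Function.Injective F)
    {P : ℕ → Submodule K (UpperShriek ℤ K V)} (h₀ : Module.Finite K (P 0))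
    (hP : ∀ b, P (b + 1) ≤ coind F (P b)) : ∃ b, ∃ c ∈ K⁰, c • coind F (P b) ≤ P (b + 1) := by
  have hfin (b : ℕ) : Module.Finite K (P b) := by
    induction b with
    | zero => exact h₀
    | succ b _ =>
      have := finite_coind hF (P b)
      exact Module.Finite.of_injective _ (Submodule.inclusion_injective (hP b))
  obtain ⟨b, hb⟩ := exists_le_succ fun b => Module.finrank K (P b)
  have := finite_coind hF (P b)
  exact ⟨b, exists_smul_le_of_le_saturation (Module.Finite.iff_fg.mp inferInstance)
    (le_saturation_of_finrank_le (hP b) ((finrank_coind_le hF hinj (P b)).trans hb))⟩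

end UpperShriek

/-! ### Test elements over a domain -/

theorem exists_map_mul_eq_sum_map_mul {K L : Type*} [CommRing K] [IsDomain K] [CommRing L]
    {F : K →+* L} (hF : F.Finite) :
    ∃ (n : ℕ) (β : Fin n → L) (π : Fin n → L →+ K) (c : K), c ≠ 0 ∧
      (∀ j x s, π j (F x * s) = x * π j s) ∧ ∀ s, F c * s = ∑ j, F (π j s) * β j := by
  let : Algebra K L := F.toAlgebra
  have : Module.Finite K L := hF
  obtain ⟨n, β, π, c, -, hc, hβπ⟩ := exists_smul_eq_sum_dual_smul K L
  exact ⟨n, β, fun j => (π j).toAddMonoidHom, c, hc, fun j x s => (π j).map_smul x s, hβπ⟩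

namespace CartierAction

section ActHom

variable {p : ℕ} [Fact p.Prime] {R : Type u} [CommRing R] [CharP R p]
  {C : CartierAlgebra.{u, v} p R} {M : Type x} [AddCommGroup M] [Module R M]
  (A : CartierAction C M)

/-- The additive map `s ↦ κ (s ^ p ^ j • v)`. -/
def actHom {e : ℕ} (κ : C.gr e) (j : ℕ) (v : M) : UpperShriek ℤ R M :=
  (((A.act κ).comp (((smulAddHom R M).flip v).comp
    (frobPow p R R j).toAddMonoidHom)).toIntLinearMap : R →ₗ[ℤ] M)

@[simp]
theorem actHom_apply {e : ℕ} (κ : C.gr e) (j : ℕ) (v : M) (s : R) :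
    A.actHom κ j v s = A.act κ (s ^ p ^ j • v) := rfl

/-- The submodule of `Hom_R(F^b_* R, M)` generated by the maps `s ↦ κ (s ^ p ^ (e - b) • v)` with
`κ` of degree `e ≥ b` and `v ∈ Q`. -/
def actHomSpan (Q : Submodule R M) (b : ℕ) : Submodule R (UpperShriek ℤ R M) :=
  Submodule.span R {φ | ∃ e : ℕ, b ≤ e ∧ ∃ κ : C.gr e, ∃ v ∈ Q, A.actHom κ (e - b) v = φ}

variable {A} {Q N : Submodule R M} {b : ℕ} {φ : UpperShriek ℤ R M}

theorem actHomSpan_succ_le_coind :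
    A.actHomSpan Q (b + 1) ≤ UpperShriek.coind (frobenius R p) (A.actHomSpan Q b) := by
  refine Submodule.span_le.mpr ?_
  rintro _ ⟨e, he, κ, v, hv, rfl⟩ t
  refine Submodule.subset_span ⟨e, by omega, κ, t ^ p ^ (e - (b + 1)) • v, Q.smul_mem _ hv, ?_⟩
  ext s
  have h : e - b = e - (b + 1) + 1 := by omega
  simp only [actHom_apply, UpperShriek.precomp_apply, UpperShriek.smul_apply, frobenius_def, h]
  rw [smul_smul, mul_pow, ← pow_mul, ← pow_succ', mul_comm]

theorem apply_pow_mul_of_mem_actHomSpan (hφ : φ ∈ A.actHomSpan Q b) (y s : R) :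
    φ (y ^ p ^ b * s) = y • φ s := by
  induction hφ using Submodule.span_induction generalizing s with
  | mem φ hφ =>
    obtain ⟨e, he, κ, v, -, rfl⟩ := hφ
    rw [actHom_apply, actHom_apply, mul_pow, ← pow_mul, ← pow_add, Nat.add_sub_cancel' he,
      mul_smul, A.act_pow_smul]
  | zero => simp only [UpperShriek.zero_apply, smul_zero]
  | add φ ψ _ _ h₁ h₂ => simp only [UpperShriek.add_apply, h₁, h₂, smul_add]
  | smul t φ _ h => rw [UpperShriek.smul_apply, UpperShriek.smul_apply, ← h, mul_left_comm]

theorem exists_mem_actHomSpan_apply_one {v : M} (hv : v ∈ A.actSpan b Q) :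
    ∃ φ ∈ A.actHomSpan Q b, φ 1 = v := by
  induction hv using Submodule.span_induction with
  | mem v hv =>
    obtain ⟨e, he, κ, v, hv, rfl⟩ := hv
    exact ⟨_, Submodule.subset_span ⟨e, he, κ, v, hv, rfl⟩, by simp⟩
  | zero => exact ⟨0, zero_mem _, rfl⟩
  | add v v' _ _ h₁ h₂ =>
    obtain ⟨φ, hφ, rfl⟩ := h₁
    obtain ⟨φ', hφ', rfl⟩ := h₂
    exact ⟨φ + φ', add_mem hφ hφ', rfl⟩
  | smul y v _ h =>
    obtain ⟨φ, hφ, rfl⟩ := h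
    exact ⟨y ^ p ^ b • φ, Submodule.smul_mem _ _ hφ, apply_pow_mul_of_mem_actHomSpan hφ y 1⟩

theorem finite_actHomSpan_zero [IsNoetherianRing R] [Module.Finite R M] (Q : Submodule R M) :
    Module.Finite R (A.actHomSpan Q 0) := by
  have hlin {φ : UpperShriek ℤ R M} (hφ : φ ∈ A.actHomSpan Q 0) (s : R) : φ s = s • φ 1 := by
    simpa only [pow_zero, pow_one, mul_one] using apply_pow_mul_of_mem_actHomSpan hφ s 1
  let evalOne : A.actHomSpan Q 0 →ₗ[R] M :=
    { toFun := fun φ => φ.1 1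
      map_add' := fun _ _ => rfl
      map_smul' := fun t φ => by
        rw [RingHom.id_apply, ← hlin φ.2, Submodule.coe_smul, UpperShriek.smul_apply, mul_one] }
  refine Module.Finite.of_injective evalOne fun φ ψ h => Subtype.ext (UpperShriek.ext fun s => ?_)
  rw [hlin φ.2, hlin ψ.2]
  exact congrArg (s • ·) h

theorem IsCartierSubmodule.apply_mem_of_mem_actHomSpan (hN : A.IsCartierSubmodule N)
    (hφ : φ ∈ A.actHomSpan Q b) {r : R} (hr : r ∈ N.colon (Q : Set M)) : φ r ∈ N := by
  induction hφ using Submodule.span_induction generalizing r with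
  | mem φ hφ =>
    obtain ⟨e, -, κ, v, hv, rfl⟩ := hφ
    refine hN e κ (r ^ p ^ (e - b) • v) ?_
    rw [← Nat.sub_add_cancel (Nat.one_le_pow (e - b) p (Fact.out : p.Prime).pos), pow_succ,
      mul_smul]
    exact N.smul_mem _ (Submodule.mem_colon.mp hr v hv)
  | zero => exact N.zero_mem
  | add _ _ _ _ h₁ h₂ => exact N.add_mem (h₁ hr) (h₂ hr)
  | smul t _ _ h => exact h (Ideal.mul_mem_left _ t hr)

end ActHom

section TestElement

variable {p : ℕ} [Fact p.Prime] {D : Type u} [CommRing D] [CharP D p]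
  {C : CartierAlgebra.{u, v} p D} {M : Type x} [AddCommGroup M] [Module D M]
  {A : CartierAction C M} {Q N : Submodule D M} {b : ℕ} {c : D}

/-- Choose `φ` in `A.actHomSpan Q b` with `φ 1 = c ^ b • m`, where `m ∈ Q`. For `y = c * π r`, the
value `φ (y ^ p ^ b) = y • φ 1` is also the value of `c • (φ ∘ π)` at a multiple of `r`, and
`c • (φ ∘ π)` lies in `A.actHomSpan Q (b + 1)`, hence maps `N.colon Q` to `N`. -/
theorem IsCartierSubmodule.apply_mem_colon (hN : A.IsCartierSubmodule N)
    (hsat : saturation (.powers c) N ≤ N) (hplus : c • Q ≤ A.plus Q)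
    (hcoind : c • UpperShriek.coind (frobenius D p) (A.actHomSpan Q b) ≤ A.actHomSpan Q (b + 1))
    {π : D →+ D} (hπ : ∀ y s, π (frobenius D p y * s) = y * π s) {r : D}
    (hr : r ∈ N.colon (Q : Set M)) : π r ∈ N.colon (Q : Set M) := by
  refine Submodule.mem_colon.mpr fun m hm => ?_
  obtain ⟨φ, hφ, hφm⟩ := exists_mem_actHomSpan_apply_one <| A.plus_iterate_le_actSpan b Q <|
    pow_smul_le_plus_iterate hplus b (Submodule.smul_mem_pointwise_smul m (c ^ b) Q hm)
  let ψ : UpperShriek ℤ D M := (LinearMap.comp (φ : D →ₗ[ℤ] M) π.toIntLinearMap : D →ₗ[ℤ] M)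
  have hψ : ψ ∈ UpperShriek.coind (frobenius D p) (A.actHomSpan Q b) := fun t => by
    have h : UpperShriek.precomp (frobenius D p) (t • ψ) = π t • φ := UpperShriek.ext fun s => by
      change φ (π (t * frobenius D p s)) = φ (π t * s)
      rw [mul_comm t, hπ, mul_comm]
    rw [h]
    exact Submodule.smul_mem _ _ hφ
  have hcψ := hcoind (Submodule.smul_mem_pointwise_smul ψ c _ hψ)
  obtain ⟨y, hy⟩ : ∃ y, y = c * π r := ⟨_, rfl⟩
  have hmem : φ (y ^ p ^ b * 1) ∈ N := by
    have hp := (Fact.out : p.Prime).pos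
    have h : π (c * (c ^ (p - 1) * (y ^ (p ^ b - 1)) ^ p * r)) = y ^ p ^ b * 1 := by
      have hpow : c * (c ^ (p - 1) * (y ^ (p ^ b - 1)) ^ p * r) =
          frobenius D p (c * y ^ (p ^ b - 1)) * r := by
        rw [frobenius_def, mul_pow, ← mul_assoc, ← mul_assoc, mul_pow_sub_one hp.ne']
      rw [hpow, hπ, mul_right_comm, ← hy, mul_pow_sub_one (pow_pos hp b).ne', mul_one]
    rw [← h]
    exact hN.apply_mem_of_mem_actHomSpan hcψ (Ideal.mul_mem_left _ _ hr)
  rw [apply_pow_mul_of_mem_actHomSpan hφ, hφm, hy] at hmem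
  refine hsat ⟨c ^ (b + 1), ⟨b + 1, rfl⟩, ?_⟩
  rwa [smul_smul, mul_right_comm, ← pow_succ', mul_smul] at hmem

theorem IsCartierSubmodule.exists_pow_mem_colon [IsDomain D] [IsNoetherianRing D]
    (hN : A.IsCartierSubmodule N)
    (hsat : saturation (.powers c) N ≤ N) (hplus : c • Q ≤ A.plus Q)
    (hcoind : c • UpperShriek.coind (frobenius D p) (A.actHomSpan Q b) ≤ A.actHomSpan Q (b + 1))
    {n : ℕ} {β : Fin n → D} {π : Fin n → D →+ D}
    (hπ : ∀ j y s, π j (frobenius D p y * s) = y * π j s) {a : D}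
    (hβπ : ∀ s, frobenius D p a * s = ∑ j, frobenius D p (π j s) * β j)
    (hne : N.colon (Q : Set M) ≠ ⊥) : ∃ k : ℕ, a ^ k ∈ N.colon (Q : Set M) := by
  set J := N.colon (Q : Set M)
  have hle : frobenius D p a • J ≤ J * J := by
    refine Submodule.map_le_iff_le_comap.mpr fun s hs => ?_
    change frobenius D p a * s ∈ J * J
    rw [hβπ]
    refine Ideal.sum_mem _ fun j _ => Ideal.mul_mem_right _ _ ?_
    rw [← sq]
    exact Ideal.pow_le_pow_right (Fact.out : p.Prime).two_le <|
      Ideal.pow_mem_pow (hN.apply_mem_colon hsat hplus hcoind (hπ j) hs) p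
  obtain ⟨k, hk⟩ := exists_pow_mem_of_smul_le_mul_self hne hle
  exact ⟨p * k, by rwa [pow_mul]⟩

end TestElement

end CartierAction

theorem smul_le_of_dvd {R M : Type*} [CommRing R] [AddCommGroup M] [Module R M]
    {N N' : Submodule R M} {c d : R} (hcd : c ∣ d) (h : c • N ≤ N') : d • N ≤ N' := by
  obtain ⟨t, rfl⟩ := hcd
  rw [mul_comm, mul_smul]
  exact (Submodule.smul_le_self_of_tower t _).trans h

namespace CartierAction

section Domain

variable {p : ℕ} {D : Type u} [CommRing D] [IsDomain D] [IsNoetherianRing D]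
  {C : CartierAlgebra.{u, v} p D} {M : Type x} [AddCommGroup M] [Module D M] [Module.Finite D M]

theorem exists_smul_plus_iterate_le_plus (A : CartierAction C M) :
    ∃ n, ∃ c : D, c ≠ 0 ∧ c • A.plus^[n] ⊤ ≤ A.plus (A.plus^[n] ⊤) := by
  have htop : A.IsCartierSubmodule ⊤ := fun _ _ _ _ => trivial
  obtain ⟨n, c, hc, h⟩ := exists_smul_le_succ_of_antitone htop.plus_iterate_antitone
  rw [Function.iterate_succ_apply'] at h
  exact ⟨n, c, nonZeroDivisors.ne_zero hc, h⟩

theorem isNilAt_bot_iff {A : CartierAction C M} {N : Submodule D M} :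
    A.IsNilAt ⊥ N ↔ ∃ n, ∃ c : D, c ≠ 0 ∧ c • A.plus^[n] ⊤ ≤ N := by
  have htop : Submodule.torsionBySet D M (⊥ : Ideal D) = ⊤ := by
    refine Submodule.eq_top_iff'.mpr fun m => ?_
    rw [Submodule.mem_torsionBySet_iff]
    rintro ⟨a, rfl : a = 0⟩
    exact zero_smul D m
  simp only [IsNilAt, htop, Ideal.primeCompl_bot]
  refine exists_congr fun n => ⟨fun h => ?_, fun ⟨c, hc, h⟩ =>
    le_saturation_of_smul_le (mem_nonZeroDivisors_of_ne_zero hc) h⟩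
  obtain ⟨c, hc, h⟩ := exists_smul_le_of_le_saturation (IsNoetherian.noetherian _) h
  exact ⟨c, nonZeroDivisors.ne_zero hc, h⟩

variable [Fact p.Prime] [CharP D p]

theorem exists_forall_pow_smul_le {A : CartierAction C M} (hD : (frobenius D p).Finite)
    {Q : Submodule D M} {c₀ : D} (hc₀ : c₀ ≠ 0) (h₀ : c₀ • Q ≤ A.plus Q) :
    ∃ c : D, c ≠ 0 ∧ c • Q ≤ A.plus Q ∧ ∀ N : Submodule D M, A.IsCartierSubmodule N →
      ∀ d : D, d ≠ 0 → d • Q ≤ N → ∃ k : ℕ, c ^ k • Q ≤ N := by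
  obtain ⟨b, c₁, hc₁, hcoind⟩ := UpperShriek.exists_smul_coind_le hD (frobenius_inj D p)
    (P := A.actHomSpan Q) (finite_actHomSpan_zero Q) fun b => actHomSpan_succ_le_coind
  obtain ⟨n, β, π, a, ha, hπ, hβπ⟩ := exists_map_mul_eq_sum_map_mul hD
  have hplus : (c₀ * c₁ * a) • Q ≤ A.plus Q := smul_le_of_dvd ⟨c₁ * a, by ring⟩ h₀
  refine ⟨c₀ * c₁ * a, mul_ne_zero (mul_ne_zero hc₀ (nonZeroDivisors.ne_zero hc₁)) ha, hplus,
    fun N hN d hd hdN => ?_⟩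
  set c := c₀ * c₁ * a
  let N' := saturation (.powers c) N
  have hne : N'.colon (Q : Set M) ≠ ⊥ := (Submodule.ne_bot_iff _).mpr
    ⟨d, Submodule.mem_colon_iff_le.mpr (hdN.trans le_saturation), hd⟩
  obtain ⟨k, hk⟩ := (isCartierSubmodule_saturation hN _).exists_pow_mem_colon
    (saturation_le_saturation_iff.mpr le_rfl) hplus (smul_le_of_dvd ⟨c₀ * a, by ring⟩ hcoind)
    hπ hβπ hne
  have hQ : Q ≤ N' := (le_saturation_of_smul_le (pow_mem (Submonoid.mem_powers c) k) <|
    smul_le_of_dvd (pow_dvd_pow_of_dvd (Dvd.intro_left _ rfl) k)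
      (Submodule.mem_colon_iff_le.mp hk)).trans (saturation_le_saturation_iff.mpr le_rfl)
  obtain ⟨_, ⟨k, rfl⟩, hk⟩ := exists_smul_le_of_le_saturation (IsNoetherian.noetherian Q) hQ
  exact ⟨k, hk⟩

theorem exists_isLeast_isNilAt_bot (A : CartierAction C M) (hD : (frobenius D p).Finite) :
    ∃ T, IsLeast {N | A.IsCartierSubmodule N ∧ A.IsNilAt ⊥ N} T := by
  have htop : A.IsCartierSubmodule ⊤ := fun _ _ _ _ => trivial
  obtain ⟨n, c₀, hc₀, h₀⟩ := A.exists_smul_plus_iterate_le_plus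
  obtain ⟨c, hc, hplus, hpow⟩ := exists_forall_pow_smul_le hD hc₀ h₀
  refine ⟨A.actSpan 0 (c ^ 3 • A.plus^[n] ⊤), ⟨isCartierSubmodule_actSpan 0 _,
    isNilAt_bot_iff.mpr ⟨n, c ^ 3, pow_ne_zero 3 hc, A.le_actSpan_zero _⟩⟩, fun N ⟨hN, hnil⟩ => ?_⟩
  obtain ⟨k, d, hd, hdN⟩ := isNilAt_bot_iff.mp hnil
  have hle : (d * c ^ k) • A.plus^[n] ⊤ ≤ N := calc
    (d * c ^ k) • A.plus^[n] ⊤ = d • c ^ k • A.plus^[n] ⊤ := mul_smul _ _ _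
    _ ≤ d • A.plus^[k] (A.plus^[n] ⊤) := smul_mono_right d (pow_smul_le_plus_iterate hplus k)
    _ = d • A.plus^[k + n] ⊤ := by rw [Function.iterate_add_apply]
    _ ≤ d • A.plus^[k] ⊤ := smul_mono_right d (htop.plus_iterate_antitone (Nat.le_add_right k n))
    _ ≤ N := hdN
  obtain ⟨l, hl⟩ := hpow N hN _ (mul_ne_zero hd (pow_ne_zero k hc)) hle
  exact (A.actSpan_mono 0 (hN.pow_three_smul_le hplus hl)).trans (hN.actSpan_le 0)

end Domain

end CartierAction

/-! ### Existence of test modules and the trace -/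

theorem frobenius_finite_of_finite {p : ℕ} [Fact p.Prime] {R S : Type*} [CommRing R] [CharP R p]
    [CommRing S] [CharP S p] [Algebra R S] [Module.Finite R S] (hR : (frobenius R p).Finite) :
    (frobenius S p).Finite := by
  have h : ((algebraMap R S).comp (frobenius R p)).Finite :=
    RingHom.Finite.comp (RingHom.finite_algebraMap.mpr inferInstance) hR
  rw [(algebraMap R S).frobenius_comm p] at h
  exact RingHom.Finite.of_comp_finite h

theorem surjective_comap_of_denseRange {R S : Type*} [CommRing R] [CommRing S] [Algebra R S]
    [Algebra.IsIntegral R S] (hdom : DenseRange (PrimeSpectrum.comap (algebraMap R S))) :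
    Function.Surjective (PrimeSpectrum.comap (algebraMap R S)) := by
  have hclosed := (PrimeSpectrum.isClosedMap_comap_of_isIntegral (algebraMap R S)
    (algebraMap_isIntegral_iff.mpr inferInstance)).isClosed_range
  rw [← Set.range_eq_univ, ← hclosed.closure_eq, hdom.closure_eq]

namespace CartierAction

section TestModule

variable {p : ℕ} [Fact p.Prime] {R : Type u} [CommRing R] [CharP R p] [IsNoetherianRing R]
  {C : CartierAlgebra.{u, v} p R} {M : Type x} [AddCommGroup M] [Module R M] [Module.Finite R M]

theorem exists_isLeast_isNilAt (A : CartierAction C M) (hR : (frobenius R p).Finite) (η : Ideal R)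
    [η.IsPrime] : ∃ T, IsLeast {N | A.IsCartierSubmodule N ∧ A.IsNilAt η N} T := by
  have : CharP (R ⧸ η) p := (CharP.charP_iff_prime_eq_zero Fact.out).mpr <| by
    rw [← map_natCast (Ideal.Quotient.mk η), CharP.cast_eq_zero, map_zero]
  have : (⊥ : Ideal (R ⧸ η)).LiesOver η := ⟨Ideal.mk_ker.symm⟩
  obtain ⟨T, ⟨hT, hnil⟩, hleast⟩ :=
    (A.upperShriek (R ⧸ η)).exists_isLeast_isNilAt_bot (frobenius_finite_of_finite hR)
  exact ⟨UpperShriek.traceImage T, ⟨hT.traceImage, hnil.traceImage η ⊥⟩, fun N ⟨hN, hN'⟩ =>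
    (UpperShriek.gc_traceImage_submodule _ _).mpr (hleast ⟨hN.submodule, hN'.submodule η ⊥⟩)⟩

theorem isTestModule_testModule (A : CartierAction C M) (hR : (frobenius R p).Finite) :
    A.IsTestModule A.testModule := by
  have hex (η : associatedPrimes R M) :
      ∃ T, IsLeast {N | A.IsCartierSubmodule N ∧ A.IsNilAt η.1 N} T :=
    have : η.1.IsPrime := η.2.isPrime
    A.exists_isLeast_isNilAt hR η.1
  choose T hT using hex
  have h : IsLeast A.testFamily (⨆ η, T η) := by
    refine ⟨mem_testFamily_iff.mpr ⟨IsCartierSubmodule.iSup fun η => (hT η).1.1, fun η _ hη =>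
      (hT ⟨η, hη⟩).1.2.mono (le_iSup T ⟨η, hη⟩)⟩, fun N hN => iSup_le fun η => ?_⟩
    obtain ⟨hN, hnil⟩ := mem_testFamily_iff.mp hN
    have : η.1.IsPrime := η.2.isPrime
    exact (hT η).2 ⟨hN, hnil η.1 η.2⟩
  rwa [IsTestModule, show A.testModule = ⨆ η, T η from h.isGLB.sInf_eq]

variable {A : CartierAction C M} {S : Type w} [CommRing S] [CharP S p] [Algebra R S]
  [Module.Finite R S]

theorem submodule_mem_testFamily {N : Submodule R M} (hN : N ∈ A.testFamily) :
    UpperShriek.submodule S N ∈ (A.upperShriek S).testFamily := by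
  have : IsNoetherianRing S := IsNoetherianRing.of_finite R S
  obtain ⟨hN, hnil⟩ := mem_testFamily_iff.mp hN
  refine mem_testFamily_iff.mpr ⟨hN.submodule, fun ξ _ hξ => ?_⟩
  exact (hnil _ (under_mem_associatedPrimes hξ)).submodule (ξ.under R) ξ

theorem traceImage_mem_testFamily
    (hsupp : Module.support R M ⊆ Set.range (PrimeSpectrum.comap (algebraMap R S)))
    {N' : Submodule S (UpperShriek R S M)} (hN' : N' ∈ (A.upperShriek S).testFamily) :
    UpperShriek.traceImage N' ∈ A.testFamily := by
  have : IsNoetherianRing S := IsNoetherianRing.of_finite R S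
  obtain ⟨hN', hnil⟩ := mem_testFamily_iff.mp hN'
  refine mem_testFamily_iff.mpr ⟨hN'.traceImage, fun η hprime hη => ?_⟩
  obtain ⟨ξ, hξη⟩ := hsupp <| (Module.mem_support_iff_of_finite (p := ⟨η, hprime⟩)).mpr
    (Submodule.annihilator_top.symm.trans_le hη.annihilator_le)
  have : ξ.asIdeal.LiesOver η := ⟨(congrArg PrimeSpectrum.asIdeal hξη).symm⟩
  exact (hnil _ (mem_associatedPrimes_upperShriek η ξ.asIdeal hη)).traceImage η ξ.asIdeal

end TestModule

end CartierAction

theorem mainTheorem1_general {p : ℕ} [Fact p.Prime]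
    {R : Type u} [CommRing R] [CharP R p] [IsNoetherianRing R]
    (hR : (frobenius R p).Finite)
    {S : Type w} [CommRing S] [CharP S p] [Algebra R S] [Module.Finite R S]
    (C : CartierAlgebra.{u, v} p R)
    {M : Type x} [AddCommGroup M] [Module R M] [Module.Finite R M]
    (hsupp : Module.support R M ⊆ Set.range (PrimeSpectrum.comap (algebraMap R S)))
    (A : CartierAction C M) :
    A.IsTestModule A.testModule ∧
    (A.upperShriek S).IsTestModule (A.upperShriek S).testModule ∧
    ((A.upperShriek S).testModule.restrictScalars R).map (UpperShriek.trace R S M) =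
      A.testModule ∧
    (A.IsFRegular → Function.Surjective (UpperShriek.trace R S M)) ∧
    (Function.Surjective (UpperShriek.trace R S M) → (A.upperShriek S).IsFRegular →
      A.IsFRegular) := by
  have : IsNoetherianRing S := IsNoetherianRing.of_finite R S
  have hM := A.isTestModule_testModule hR
  have hS := (A.upperShriek S).isTestModule_testModule (frobenius_finite_of_finite hR)
  have htrace : UpperShriek.traceImage (A.upperShriek S).testModule = A.testModule := le_antisymm
    ((UpperShriek.gc_traceImage_submodule _ _).mpr <|
      hS.2 (CartierAction.submodule_mem_testFamily hM.1))
    (hM.2 (CartierAction.traceImage_mem_testFamily hsupp hS.1))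
  refine ⟨hM, hS, htrace, fun hreg => ?_, fun hsurj hreg => ?_⟩
  · exact LinearMap.range_eq_top.mp (top_le_iff.mp (hreg ▸ htrace ▸ LinearMap.map_le_range))
  · rw [CartierAction.IsFRegular, ← htrace, hreg]
    exact (Submodule.map_top _).trans (LinearMap.range_eq_top.mpr hsurj)

theorem mainTheorem1 {p : ℕ} [Fact p.Prime]
    {R : Type u} [CommRing R] [CharP R p] [IsNoetherianRing R]
    (hR : (frobenius R p).Finite)
    {S : Type w} [CommRing S] [CharP S p] [Algebra R S] [Module.Finite R S]
    (hdom : DenseRange (PrimeSpectrum.comap (algebraMap R S)))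
    (C : CartierAlgebra.{u, v} p R)
    {M : Type x} [AddCommGroup M] [Module R M] [Module.Finite R M]
    (A : CartierAction C M) :
    A.IsTestModule A.testModule ∧
    (A.upperShriek S).IsTestModule (A.upperShriek S).testModule ∧
    ((A.upperShriek S).testModule.restrictScalars R).map (UpperShriek.trace R S M) =
      A.testModule ∧
    (A.IsFRegular → Function.Surjective (UpperShriek.trace R S M)) ∧
    (Function.Surjective (UpperShriek.trace R S M) → (A.upperShriek S).IsFRegular →
      A.IsFRegular) :=
  mainTheorem1_general hR C
    ((surjective_comap_of_denseRange hdom).range_eq ▸ Set.subset_univ _) A
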